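/- Lemma 4.3. Let $n\ge 1$. A ranking is a permutation $\sigma$ of $[n]=\{1,\dots,n\}$, where $\sigma(x)$ is the position of element $x$. For $A\subseteq[n]$ and $u\in A$ let $\sigma_A(u)\in\{1,\dots,|A|\}$ be the rank of $u$ in the projection of $\sigma$ onto $A$, that is, the number of $y\in A$ with $\sigma(y)\le\sigma(u)$. Let $d_\tau(\sigma,\pi)=|\{(x,y):\pi(x)>\pi(y),\ \sigma(x)<\sigma(y)\}|$ be the Kendall $\tau$ distance. For a ranking $\sigma_0$ and $\phi\in(0,1]$, write $\sigma\sim\mathrm{MM}(\sigma_0,\phi)$ (the Mallows model) if each ranking $\sigma$ has probability proportional to $\phi^{d_\tau(\sigma_0,\sigma)}$. Write $\phi_{s:t}=\sum_{k=s}^{t}\phi^k$ (equal to $0$ if $t<s$). Let $\sigma\sim\mathrm{MM}(\sigma_0,\phi)$, let $A\subseteq[n]$ and $u\in A$, and put $$M=\max_{l\in\{0,1,\dots,n-|A|\}}\frac{\phi+\phi^{l}\phi_{2:n-l-1}}{1+\phi^{2l}\phi_{3:n-l}}.$$ Then $\mathbb P[\sigma_A(u)=j]>0$ for all $1\le j\le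 |A|$, and 1. $\dfrac{\mathbb P[\sigma_A(u)=j+1]}{\mathbb P[\sigma_A(u)=j]}\le M$ whenever $\sigma_{0,A}(u)\le j<|A|$; 2. $\dfrac{\mathbb P[\sigma_A(u)=j-1]}{\mathbb P[\sigma_A(u)=j]}\le M$ whenever $1<j\le\sigma_{0,A}(u)$. Equality holds in 1 when $A=[n]$, $\sigma_0(u)=n-1$ and $j=\sigma_0(u)$, and equality holds in 2 when $A=[n]$, $\sigma_0(u)=2$ and $j=\sigma_0(u)$. Moreover, if $n\ge 2$ and $\phi+\phi^2<1+\phi^n$, then $$M\le\frac{\phi_{1:n-1}}{1+\phi_{3:n}}.$$ -/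

import Mathlib

/-! Rankings of `n` elements are permutations `σ` of `Fin n`; `σ x` is the (zero-based) position of
the element `x`. Ranks of projected rankings are counted from `1`. -/

namespace Mallows

/-- Kendall tau distance: the number of pairs `(x, y)` with `π x > π y` and `σ x < σ y`. -/
def kendallTau {n : ℕ} (σ π : Equiv.Perm (Fin n)) : ℕ :=
  (Finset.univ.filter fun p : Fin n × Fin n => π p.1 > π p.2 ∧ σ p.1 < σ p.2).card

/-- The rank `σ_A(u) ∈ {1, …, |A|}` of an element `u ∈ A` in the projection of `σ` onto `A`. -/
def projRank {n : ℕ} (σ : Equiv.Perm (Fin n)) (A : Finset (Fin n)) (u : Fin n) : ℕ :=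
  (A.filter fun y => σ y ≤ σ u).card

/-- The projection of a ranking orders the elements of `A` as the ranking does. -/
theorem projRank_lt_iff {n : ℕ} (σ : Equiv.Perm (Fin n)) (A : Finset (Fin n)) {x y : Fin n}
    (hx : x ∈ A) : projRank σ A y < projRank σ A x ↔ σ y < σ x := by
  constructor
  · intro h
    by_contra hle
    refine absurd h (not_lt.2 (Finset.card_le_card fun z hz => ?_))
    rw [Finset.mem_filter] at hz ⊢
    exact ⟨hz.1, hz.2.trans (not_lt.1 hle)⟩
  · intro h
    refine Finset.card_lt_card ⟨fun z hz => ?_, fun hsub => ?_⟩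
    · rw [Finset.mem_filter] at hz ⊢
      exact ⟨hz.1, hz.2.trans h.le⟩
    · have := hsub (Finset.mem_filter.2 ⟨hx, le_refl (σ x)⟩)
      exact absurd (Finset.mem_filter.1 this).2 (not_le.2 h)

/-- The projection of a ranking onto `A` is a bijection from `A` to `{1, …, |A|}`. -/
theorem projRank_bijOn {n : ℕ} (σ : Equiv.Perm (Fin n)) (A : Finset (Fin n)) :
    Set.BijOn (projRank σ A) (A : Set (Fin n)) (Finset.Icc 1 A.card : Set ℕ) := by
  have hmaps : Set.MapsTo (projRank σ A) (A : Set (Fin n)) (Finset.Icc 1 A.card : Set ℕ) := by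
    intro x hx
    rw [Finset.mem_coe, Finset.mem_Icc]
    exact ⟨Finset.card_pos.2 ⟨x, Finset.mem_filter.2 ⟨hx, le_refl _⟩⟩,
      Finset.card_le_card (Finset.filter_subset _ _)⟩
  have hinj : Set.InjOn (projRank σ A) (A : Set (Fin n)) := by
    intro x hx y hy h
    have h1 := projRank_lt_iff σ A (x := x) (y := y) hx
    have h2 := projRank_lt_iff σ A (x := y) (y := x) hy
    rw [h] at h1 h2
    have h3 := mt h1.2 (lt_irrefl _)
    have h4 := mt h2.2 (lt_irrefl _)
    exact σ.injective (le_antisymm (not_lt.1 h3) (not_lt.1 h4))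
  exact ⟨hmaps, hinj, Finset.surjOn_of_injOn_of_card_le _ hmaps hinj (by simp)⟩

/-- The probability of the ranking `σ` under the Mallows model with centroid `σ₀` and
parameter `φ`: it is proportional to `φ ^ kendallTau σ₀ σ`. -/
noncomputable def mallowsMass {n : ℕ} (σ₀ : Equiv.Perm (Fin n)) (φ : ℝ)
    (σ : Equiv.Perm (Fin n)) : ℝ :=
  φ ^ kendallTau σ₀ σ / ∑ π : Equiv.Perm (Fin n), φ ^ kendallTau σ₀ π

/-- For `φ > 0` the Mallows masses are positive. -/
theorem mallowsMass_pos {n : ℕ} (σ₀ : Equiv.Perm (Fin n)) {φ : ℝ} (hφ : 0 < φ)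
    (σ : Equiv.Perm (Fin n)) : 0 < mallowsMass σ₀ φ σ :=
  div_pos (pow_pos hφ _)
    (Finset.sum_pos (fun _ _ => pow_pos hφ _) Finset.univ_nonempty)

/-- For `φ > 0` the Mallows masses sum to one. -/
theorem sum_mallowsMass {n : ℕ} (σ₀ : Equiv.Perm (Fin n)) {φ : ℝ} (hφ : 0 < φ) :
    ∑ σ : Equiv.Perm (Fin n), mallowsMass σ₀ φ σ = 1 := by
  have h : (0 : ℝ) < ∑ π : Equiv.Perm (Fin n), φ ^ kendallTau σ₀ π :=
    Finset.sum_pos (fun _ _ => pow_pos hφ _) Finset.univ_nonempty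
  unfold mallowsMass
  rw [← Finset.sum_div, div_self h.ne']

/-- The probability that `σ_A(u) = j` for a ranking `σ` drawn from the Mallows model
with centroid `σ₀` and parameter `φ`. -/
noncomputable def probRankEq {n : ℕ} (σ₀ : Equiv.Perm (Fin n)) (φ : ℝ) (A : Finset (Fin n))
    (u : Fin n) (j : ℕ) : ℝ :=
  ∑ σ : Equiv.Perm (Fin n) with projRank σ A u = j, mallowsMass σ₀ φ σ

/-- `φ_{s:t}`, the sum of `φ ^ k` over `s ≤ k ≤ t` (zero if `t < s`). -/
noncomputable def powSum (φ : ℝ) (s t : ℕ) : ℝ :=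
  ∑ k ∈ Finset.Icc s t, φ ^ k

/-- The maximum of `(φ + φ^l φ_{2:n-l-1}) / (1 + φ^{2l} φ_{3:n-l})` over the integers
`0 ≤ l ≤ n - a`. The subtractions are exact when `1 ≤ a ≤ n`. -/
noncomputable def ratioBound (n a : ℕ) (φ : ℝ) : ℝ :=
  (Finset.Icc 0 (n - a)).sup' (Finset.nonempty_Icc.2 (Nat.zero_le _)) fun l =>
    (φ + φ ^ l * powSum φ 2 (n - l - 1)) / (1 + φ ^ (2 * l) * powSum φ 3 (n - l))

end Mallows

namespace Mallows

open Finset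

/-! Relabelling the elements by `σ₀` makes the identity the centroid, so that a ranking weighs `φ`
to its number of inversions. Everything rests on one count (`kendallTau_one_mul_swap`): exchanging
an inverted pair `a < b` removes `1 + 2k` inversions, `k` being the number of elements between them
both in value and in position.

Let `N` and `D` be the weights of the rankings giving `u` rank `j + 1` and rank `j`. Split both by
the element `y` holding the other of these two ranks, and by the set `E` of elements outside `A`
placed between ranks `j - 1` and `j + 1`. Since `E`, `u`, `y` fill an interval of positions up to
the last of `u`, `y`, the two orders of `u`, `y` have weights in a fixed proportion
(`weight_pairSet_swap`): `N_y = c_y D_y`, where `c_y = φ^{-(m+1)}` if `y < u` with `m` elements of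
`E` in value between them, and `c_y ≤ φ` if `y > u`.

Next fix the set `J` of elements of `A` other than `u` with rank at most `j + 1`, while `u` has rank
`j`. Then `y` is the last of `J`, and `u` and `E` lie in position between `y` and the rest of `J`.
Exchanges inside `J` show that small last elements are rare (`lastSum_classSet_le`). As the centroid
rank of `u` is at most `j`, the maximum `x` of `J` exceeds `u`. Let `T` be the weight with a given
last element. An element `y < u` with `i` members of `J` between it and `u` contributes at most `φ^i
max(0, φ^{m+2} - M φ^{2m+3}) T(x)` to `N - M D`, while `x` contributes at most `(φ - M) T(x)`. The
powers `φ^i` sum to a geometric sum, and the total is nonpositive because `M` dominates the quotient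
for every `l = m ≤ n - |A|`.

Reversing all rankings turns the second bound into the first. If `A = [n]` and `u` is second to last
in the centroid, there is one pair `(E, J)` and every estimate is an equality. The closed bound
holds because the quotient is then largest at `l = 0`. -/

/-! ### Inversions under the exchange of two elements -/

theorem projRank_mul_swap {n : ℕ} (σ : Equiv.Perm (Fin n)) (A : Finset (Fin n)) {a b : Fin n}
    (hab : a ∈ A ↔ b ∈ A) (v : Fin n) :
    projRank (σ * Equiv.swap a b) A v = projRank σ A (Equiv.swap a b v) := by
  unfold projRank
  refine Finset.card_equiv (Equiv.swap a b) fun y => ?_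
  have : y ∈ A ↔ Equiv.swap a b y ∈ A := by
    by_cases h1 : y = a
    · subst h1; simpa using hab
    · by_cases h2 : y = b
      · subst h2; simpa using hab.symm
      · rw [Equiv.swap_apply_of_ne_of_ne h1 h2]
  rw [Finset.mem_filter, Finset.mem_filter, ← this]
  rfl

/-- The elements `z` lying strictly between `a` and `b` both in value and in position. -/
def betweenSet {n : ℕ} (σ : Equiv.Perm (Fin n)) (a b : Fin n) : Finset (Fin n) :=
  univ.filter fun z => (a < z ∧ z < b) ∧ σ b < σ z ∧ σ z < σ a

theorem kendallTau_one_eq_sum {n : ℕ} (σ : Equiv.Perm (Fin n)) :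
    kendallTau 1 σ = ∑ x, ∑ y, if x < y ∧ σ y < σ x then 1 else 0 := by
  unfold kendallTau
  rw [Finset.card_filter, Fintype.sum_prod_type]
  simp only [Equiv.Perm.one_apply, gt_iff_lt, and_comm]

/-- Isolates the pairs that meet `{a, b}`, the only ones affected by exchanging `a` and `b`. -/
theorem sum_sum_eq_of_pair {ι : Type*} [Fintype ι] [DecidableEq ι] {a b : ι} (hab : a ≠ b)
    (g : ι → ι → ℕ) :
    ∑ x, ∑ y, g x y = (∑ x ∈ univ \ {a, b}, ∑ y ∈ univ \ {a, b}, g x y)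
      + ∑ z ∈ univ \ {a, b}, (g z a + g z b + g a z + g b z)
      + (g a a + g a b + g b a + g b b) := by
  have h : ∀ f : ι → ℕ, ∑ x, f x = ∑ x ∈ univ \ {a, b}, f x + (f a + f b) := by
    intro f
    rw [← Finset.sum_sdiff (Finset.subset_univ {a, b}), Finset.sum_pair hab]
  rw [h]
  simp only [h, Finset.sum_add_distrib]
  ring

/-- Exchanging an inverted pair `a < b` removes one inversion for the pair and two for each
element between `a` and `b` in both value and position. -/
theorem kendallTau_one_mul_swap {n : ℕ} (σ : Equiv.Perm (Fin n)) {a b : Fin n} (hab : a < b)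
    (hσ : σ b < σ a) :
    kendallTau 1 σ
      = 1 + 2 * (betweenSet σ a b).card + kendallTau 1 (σ * Equiv.swap a b) := by
  rw [kendallTau_one_eq_sum, kendallTau_one_eq_sum, sum_sum_eq_of_pair hab.ne,
    sum_sum_eq_of_pair hab.ne (fun x y =>
      if x < y ∧ (σ * Equiv.swap a b) y < (σ * Equiv.swap a b) x then 1 else 0)]
  have hne : ∀ z ∈ (univ \ {a, b} : Finset (Fin n)), z ≠ a ∧ z ≠ b := by
    intro z hz
    simpa [not_or] using hz
  have hout : ∑ x ∈ univ \ {a, b}, ∑ y ∈ univ \ {a, b},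
        (if x < y ∧ (σ * Equiv.swap a b) y < (σ * Equiv.swap a b) x then 1 else 0)
      = ∑ x ∈ univ \ {a, b}, ∑ y ∈ univ \ {a, b}, if x < y ∧ σ y < σ x then 1 else 0 := by
    refine Finset.sum_congr rfl fun x hx => Finset.sum_congr rfl fun y hy => ?_
    rw [Equiv.Perm.mul_apply, Equiv.Perm.mul_apply,
      Equiv.swap_apply_of_ne_of_ne (hne x hx).1 (hne x hx).2,
      Equiv.swap_apply_of_ne_of_ne (hne y hy).1 (hne y hy).2]
  have hcard : (betweenSet σ a b).card
      = ∑ z ∈ univ \ {a, b}, if (a < z ∧ z < b) ∧ σ b < σ z ∧ σ z < σ a then 1 else 0 := by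
    rw [← Finset.card_filter]
    congr 1
    ext z
    simp only [betweenSet, mem_filter, mem_univ, true_and, mem_sdiff, mem_insert, mem_singleton,
      not_or]
    exact ⟨fun h => ⟨⟨h.1.1.ne', h.1.2.ne⟩, h⟩, fun h => h.2⟩
  rw [hout, hcard]
  have hmid : ∑ z ∈ univ \ {a, b}, ((if z < a ∧ σ a < σ z then 1 else 0)
        + (if z < b ∧ σ b < σ z then 1 else 0) + (if a < z ∧ σ z < σ a then 1 else 0)
        + (if b < z ∧ σ z < σ b then 1 else 0))
      = 2 * (∑ z ∈ univ \ {a, b}, if (a < z ∧ z < b) ∧ σ b < σ z ∧ σ z < σ a then 1 else 0)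
        + ∑ z ∈ univ \ {a, b}, ((if z < a ∧ σ b < σ z then 1 else 0)
        + (if z < b ∧ σ a < σ z then 1 else 0) + (if a < z ∧ σ z < σ b then 1 else 0)
        + (if b < z ∧ σ z < σ a then 1 else 0)) := by
    rw [Finset.mul_sum, ← Finset.sum_add_distrib]
    refine Finset.sum_congr rfl fun z hz => ?_
    have h1 := (hne z hz).1
    have h2 := (hne z hz).2
    have h3 := σ.injective.ne h1
    have h4 := σ.injective.ne h2
    rcases lt_or_gt_of_ne h1 with h1 | h1 <;> rcases lt_or_gt_of_ne h2 with h2 | h2 <;>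
    rcases lt_or_gt_of_ne h3 with h3 | h3 <;> rcases lt_or_gt_of_ne h4 with h4 | h4 <;>
    first
    | exact absurd (h1.trans (hab.trans h2)) (lt_irrefl _)
    | exact absurd (h4.trans (hσ.trans h3)) (lt_irrefl _)
    | simp [h1, h2, h3, h4, h1.not_gt, h2.not_gt, h3.not_gt, h4.not_gt]
  rw [hmid]
  have hmid' : ∀ z ∈ (univ \ {a, b} : Finset (Fin n)), (σ * Equiv.swap a b) z = σ z := by
    intro z hz
    rw [Equiv.Perm.mul_apply, Equiv.swap_apply_of_ne_of_ne (hne z hz).1 (hne z hz).2]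
  have hswap : ∑ z ∈ univ \ {a, b}, ((if z < a ∧ σ b < σ z then 1 else 0)
        + (if z < b ∧ σ a < σ z then 1 else 0) + (if a < z ∧ σ z < σ b then 1 else 0)
        + (if b < z ∧ σ z < σ a then 1 else 0))
      = ∑ z ∈ univ \ {a, b},
        ((if z < a ∧ (σ * Equiv.swap a b) a < (σ * Equiv.swap a b) z then 1 else 0)
        + (if z < b ∧ (σ * Equiv.swap a b) b < (σ * Equiv.swap a b) z then 1 else 0)
        + (if a < z ∧ (σ * Equiv.swap a b) z < (σ * Equiv.swap a b) a then 1 else 0)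
        + (if b < z ∧ (σ * Equiv.swap a b) z < (σ * Equiv.swap a b) b then 1 else 0)) := by
    refine Finset.sum_congr rfl fun z hz => ?_
    rw [hmid' z hz, Equiv.Perm.mul_apply, Equiv.Perm.mul_apply, Equiv.swap_apply_left,
      Equiv.swap_apply_right]
  rw [← hswap]
  simp only [Equiv.Perm.mul_apply, Equiv.swap_apply_left, Equiv.swap_apply_right, hab, hσ,
    hab.not_gt, hσ.not_gt, lt_irrefl, false_and, and_false, and_self, if_true, if_false]
  ring

/-! ### Comparing weights by the last element of a set -/

/-- The total weight of the rankings in `X` that place `a` after the rest of `J`. -/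
noncomputable def lastSum {n : ℕ} (φ : ℝ) (X : Finset (Equiv.Perm (Fin n))) (J : Finset (Fin n))
    (a : Fin n) : ℝ :=
  ∑ σ ∈ X with ∀ z ∈ J, σ z ≤ σ a, φ ^ kendallTau 1 σ

theorem lastSum_nonneg {n : ℕ} {φ : ℝ} (hφ : 0 ≤ φ) (X : Finset (Equiv.Perm (Fin n)))
    (J : Finset (Fin n)) (a : Fin n) : 0 ≤ lastSum φ X J a :=
  Finset.sum_nonneg fun _ _ => pow_nonneg hφ _

/-- Exchanging `a` and `b` is a bijection between the rankings with `b` last and those with `a`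
last. The extra factor `φ` matches the inversion of the pair itself. -/
theorem lastSum_swap {n : ℕ} (φ : ℝ) {X : Finset (Equiv.Perm (Fin n))} {J : Finset (Fin n)}
    {a b : Fin n} (ha : a ∈ J) (hb : b ∈ J) (hab : a < b)
    (hX : ∀ σ ∈ X, σ * Equiv.swap a b ∈ X) :
    φ * lastSum φ X J b
      = ∑ σ ∈ X with ∀ z ∈ J, σ z ≤ σ a, φ ^ (1 + kendallTau 1 (σ * Equiv.swap a b)) := by
  unfold lastSum
  rw [Finset.mul_sum]
  refine Finset.sum_equiv (Equiv.mulRight (Equiv.swap a b)) (fun σ => ?_) (fun σ _ => ?_)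
  · simp only [mem_filter, Equiv.coe_mulRight]
    have hJ : ∀ z ∈ J, Equiv.swap a b z ∈ J := by
      intro z hz
      by_cases h1 : z = a
      · subst h1; simpa using hb
      · by_cases h2 : z = b
        · subst h2; simpa using ha
        · rwa [Equiv.swap_apply_of_ne_of_ne h1 h2]
    refine and_congr ⟨hX σ, fun h => ?_⟩ ?_
    · simpa [mul_assoc] using hX _ h
    · rw [Equiv.Perm.mul_apply, Equiv.swap_apply_left]
      constructor
      · intro h z hz
        exact h _ (hJ z hz)
      · intro h z hz
        simpa using h _ (hJ z hz)
  · simp [mul_assoc, pow_add]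

theorem lastSum_le_of_le_card {n : ℕ} {φ : ℝ} (hφ0 : 0 ≤ φ) (hφ1 : φ ≤ 1)
    {X : Finset (Equiv.Perm (Fin n))} {J : Finset (Fin n)} {a b : Fin n} (ha : a ∈ J)
    (hb : b ∈ J) (hab : a < b) (hX : ∀ σ ∈ X, σ * Equiv.swap a b ∈ X) (k : ℕ)
    (hk : ∀ σ ∈ X, (∀ z ∈ J, σ z ≤ σ a) → k ≤ (betweenSet σ a b).card) :
    lastSum φ X J a ≤ φ ^ (1 + 2 * k) * lastSum φ X J b := by
  rw [add_comm, pow_succ, mul_assoc, lastSum_swap φ ha hb hab hX, Finset.mul_sum, lastSum]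
  refine Finset.sum_le_sum fun σ hσ => ?_
  rw [mem_filter] at hσ
  have hba : σ b < σ a := lt_of_le_of_ne (hσ.2 b hb) (σ.injective.ne hab.ne')
  rw [kendallTau_one_mul_swap σ hab hba, ← pow_add]
  have := hk σ hσ.1 hσ.2
  exact pow_le_pow_of_le_one hφ0 hφ1 (by omega)

theorem lastSum_eq_of_card_eq {n : ℕ} (φ : ℝ)
    {X : Finset (Equiv.Perm (Fin n))} {J : Finset (Fin n)} {a b : Fin n} (ha : a ∈ J)
    (hb : b ∈ J) (hab : a < b) (hX : ∀ σ ∈ X, σ * Equiv.swap a b ∈ X) (k : ℕ)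
    (hk : ∀ σ ∈ X, (∀ z ∈ J, σ z ≤ σ a) → (betweenSet σ a b).card = k) :
    lastSum φ X J a = φ ^ (1 + 2 * k) * lastSum φ X J b := by
  rw [add_comm, pow_succ, mul_assoc, lastSum_swap φ ha hb hab hX, Finset.mul_sum, lastSum]
  refine Finset.sum_congr rfl fun σ hσ => ?_
  rw [mem_filter] at hσ
  have hba : σ b < σ a := lt_of_le_of_ne (hσ.2 b hb) (σ.injective.ne hab.ne')
  rw [kendallTau_one_mul_swap σ hab hba, ← pow_add, hk σ hσ.1 hσ.2]
  congr 1
  omega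

/-- The elements of `S` strictly between `a` and `b`. -/
def openPart {n : ℕ} (S : Finset (Fin n)) (a b : Fin n) : Finset (Fin n) :=
  S.filter fun z => a < z ∧ z < b

theorem mem_openPart {n : ℕ} {S : Finset (Fin n)} {a b z : Fin n} :
    z ∈ openPart S a b ↔ z ∈ S ∧ a < z ∧ z < b := by
  simp [openPart]

theorem card_openPart_split {n : ℕ} (S : Finset (Fin n)) {a b c : Fin n} (hac : a < c)
    (hcb : c < b) :
    (openPart S a b).card
      = (openPart S a c).card + (if c ∈ S then 1 else 0) + (openPart S c b).card := by
  have h1 : openPart S a b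
      = (openPart S a c ∪ S.filter fun z => z = c) ∪ openPart S c b := by
    ext z
    simp only [mem_openPart, mem_union, mem_filter]
    constructor
    · rintro ⟨h, h1, h2⟩
      rcases lt_trichotomy z c with h3 | h3 | h3
      · exact Or.inl (Or.inl ⟨h, h1, h3⟩)
      · exact Or.inl (Or.inr ⟨h, h3⟩)
      · exact Or.inr ⟨h, h3, h2⟩
    · rintro ((⟨h, h1, h2⟩ | ⟨h, rfl⟩) | ⟨h, h1, h2⟩)
      · exact ⟨h, h1, h2.trans hcb⟩
      · exact ⟨h, hac, hcb⟩
      · exact ⟨h, hac.trans h1, h2⟩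
  rw [h1, Finset.card_union_of_disjoint, Finset.card_union_of_disjoint]
  · congr 2
    split_ifs with hc
    · rw [Finset.card_eq_one]
      exact ⟨c, by ext z; simp only [mem_filter, mem_singleton]; exact
        ⟨fun h => h.2, fun h => ⟨h ▸ hc, h⟩⟩⟩
    · rw [Finset.card_eq_zero, Finset.filter_eq_empty_iff]
      rintro z hz rfl
      exact hc hz
  · rw [Finset.disjoint_left]
    intro z hz hz'
    rw [mem_openPart] at hz
    rw [mem_filter] at hz'
    exact hz.2.2.ne hz'.2
  · rw [Finset.disjoint_left]
    intro z hz hz'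
    rw [mem_union, mem_openPart, mem_filter] at hz
    rw [mem_openPart] at hz'
    rcases hz with hz | hz
    · exact absurd (hz.2.2.trans hz'.2.1) (lt_irrefl _)
    · exact hz'.2.1.ne' hz.2

/-- A comparison of neighbouring elements of `J` propagates to all pairs of elements of `J`. -/
theorem rel_of_rel_adjacent {n : ℕ} (φ : ℝ) (r : ℝ → ℝ → Prop)
    (htrans : ∀ x y z, r x y → r y z → r x z)
    (hmul : ∀ (k : ℕ) x y, r x y → r (φ ^ k * x) (φ ^ k * y)) {J G : Finset (Fin n)}
    (hJG : Disjoint J G) (T : Fin n → ℝ)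
    (hstep : ∀ a ∈ J, ∀ b ∈ J, a < b → openPart J a b = ∅ →
      r (T a) (φ ^ (1 + 2 * (openPart G a b).card) * T b)) :
    ∀ a ∈ J, ∀ b ∈ J, a < b →
      r (T a) (φ ^ ((openPart J a b).card + 1 + 2 * (openPart G a b).card) * T b) := by
  suffices H : ∀ m : ℕ, ∀ a ∈ J, ∀ b ∈ J, a < b → (openPart J a b).card = m →
      r (T a) (φ ^ ((openPart J a b).card + 1 + 2 * (openPart G a b).card) * T b) from
    fun a ha b hb hab => H _ a ha b hb hab rfl
  intro m
  induction m using Nat.strong_induction_on with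
  | _ m ih =>
    intro a ha b hb hab hm
    rcases (openPart J a b).eq_empty_or_nonempty with he | ⟨c, hc⟩
    · have := hstep a ha b hb hab he
      rwa [he, Finset.card_empty, zero_add]
    · rw [mem_openPart] at hc
      obtain ⟨hcJ, hac, hcb⟩ := hc
      have hcG : c ∉ G := Finset.disjoint_left.1 hJG hcJ
      have hJ := card_openPart_split J hac hcb
      have hG := card_openPart_split G hac hcb
      rw [if_pos hcJ] at hJ
      rw [if_neg hcG] at hG
      have h1 := ih _ (by omega) a ha c hcJ hac rfl
      have h2 := ih _ (by omega) c hcJ b hb hcb rfl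
      have h3 := htrans _ _ _ h1 (hmul _ _ _ h2)
      rw [← mul_assoc, ← pow_add] at h3
      convert h3 using 3
      omega

theorem projRank_mono {n : ℕ} (σ : Equiv.Perm (Fin n)) (A : Finset (Fin n)) {v w : Fin n}
    (h : σ v ≤ σ w) : projRank σ A v ≤ projRank σ A w :=
  Finset.card_le_card fun z hz => by
    rw [mem_filter] at hz ⊢
    exact ⟨hz.1, hz.2.trans h⟩

theorem projRank_sdiff_pair {n : ℕ} (σ : Equiv.Perm (Fin n)) {A : Finset (Fin n)} {u w : Fin n}
    (hu : u ∈ A) (hw : w ∈ A) (huw : u ≠ w) (v : Fin n) :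
    projRank σ A v = projRank σ (A \ {u, w}) v
      + ((if σ u ≤ σ v then 1 else 0) + (if σ w ≤ σ v then 1 else 0)) := by
  unfold projRank
  rw [Finset.card_filter, Finset.card_filter,
    ← Finset.sum_sdiff (s₁ := {u, w}) (s₂ := A), Finset.sum_pair huw]
  intro z hz
  rw [mem_insert, mem_singleton] at hz
  rcases hz with rfl | rfl <;> assumption

/-! ### Gap sets and blocks of consecutive positions -/

/-- The elements outside `A` placed between the elements of `A` of ranks `j - 1` and `j + 1`. -/
def gapSet {n : ℕ} (σ : Equiv.Perm (Fin n)) (A : Finset (Fin n)) (j : ℕ) : Finset (Fin n) :=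
  univ.filter fun v => v ∉ A ∧ (projRank σ A v + 1 = j ∨ projRank σ A v = j)

theorem mem_gapSet {n : ℕ} {σ : Equiv.Perm (Fin n)} {A : Finset (Fin n)} {j : ℕ} {v : Fin n} :
    v ∈ gapSet σ A j ↔ v ∉ A ∧ (projRank σ A v + 1 = j ∨ projRank σ A v = j) := by
  simp [gapSet]

/-- The rankings in which `u` and `w` have ranks `j` and `j + 1` in `A`, with gap set `E`. -/
def pairSet {n : ℕ} (A : Finset (Fin n)) (u w : Fin n) (j : ℕ) (E : Finset (Fin n)) :
    Finset (Equiv.Perm (Fin n)) :=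
  univ.filter fun σ => projRank σ A u = j ∧ projRank σ A w = j + 1 ∧ gapSet σ A j = E

theorem mem_pairSet {n : ℕ} {A : Finset (Fin n)} {u w : Fin n} {j : ℕ} {E : Finset (Fin n)}
    {σ : Equiv.Perm (Fin n)} :
    σ ∈ pairSet A u w j E
      ↔ projRank σ A u = j ∧ projRank σ A w = j + 1 ∧ gapSet σ A j = E := by
  simp [pairSet]

/-- The rankings in which the elements of `H` come first among the elements outside `B` that
follow exactly `m` elements of `B`. -/
def blockSet {n : ℕ} (B H : Finset (Fin n)) (m : ℕ) : Finset (Equiv.Perm (Fin n)) :=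
  univ.filter fun σ => (∀ h ∈ H, projRank σ B h = m) ∧
    ∀ v, v ∉ H → v ∉ B → projRank σ B v = m → ∀ h ∈ H, σ h < σ v

theorem mem_blockSet {n : ℕ} {B H : Finset (Fin n)} {m : ℕ} {σ : Equiv.Perm (Fin n)} :
    σ ∈ blockSet B H m ↔ (∀ h ∈ H, projRank σ B h = m) ∧
      ∀ v, v ∉ H → v ∉ B → projRank σ B v = m → ∀ h ∈ H, σ h < σ v := by
  simp [blockSet]

theorem swap_mem_iff {α : Type*} [DecidableEq α] {S : Finset α} {a b : α} (ha : a ∈ S)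
    (hb : b ∈ S) (z : α) : Equiv.swap a b z ∈ S ↔ z ∈ S := by
  by_cases h1 : z = a
  · subst h1; simp [ha, hb]
  · by_cases h2 : z = b
    · subst h2; simp [ha, hb]
    · rw [Equiv.swap_apply_of_ne_of_ne h1 h2]

theorem mul_swap_mem_blockSet {n : ℕ} {B H : Finset (Fin n)} (hBH : Disjoint B H) {m : ℕ}
    {a b : Fin n} (ha : a ∈ H) (hb : b ∈ H) {σ : Equiv.Perm (Fin n)} (hσ : σ ∈ blockSet B H m) :
    σ * Equiv.swap a b ∈ blockSet B H m := by
  have haB := Finset.disjoint_right.1 hBH ha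
  have hbB := Finset.disjoint_right.1 hBH hb
  rw [mem_blockSet] at hσ ⊢
  refine ⟨fun h hh => ?_, fun v hvH hvB hv h hh => ?_⟩
  · rw [projRank_mul_swap σ B (by simp [haB, hbB])]
    exact hσ.1 _ ((swap_mem_iff ha hb h).2 hh)
  · have hvs : Equiv.swap a b v = v := by
      refine Equiv.swap_apply_of_ne_of_ne ?_ ?_ <;> rintro rfl
      exacts [hvH ha, hvH hb]
    rw [projRank_mul_swap σ B (by simp [haB, hbB]), hvs] at hv
    rw [Equiv.Perm.mul_apply, Equiv.Perm.mul_apply, hvs]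
    exact hσ.2 v hvH hvB hv _ ((swap_mem_iff ha hb h).2 hh)

/-- The elements of a block occupy an interval of positions. -/
theorem not_between_of_mem_blockSet {n : ℕ} {B H : Finset (Fin n)} {m : ℕ}
    {σ : Equiv.Perm (Fin n)} (hσ : σ ∈ blockSet B H m) {a b v : Fin n} (ha : a ∈ H) (hb : b ∈ H)
    (hv : v ∉ H) : ¬ (σ b < σ v ∧ σ v < σ a) := by
  rintro ⟨h1, h2⟩
  rw [mem_blockSet] at hσ
  have hav := hσ.1 a ha
  have hbv := hσ.1 b hb
  by_cases hvB : v ∈ B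
  · have := (projRank_lt_iff σ B (x := v) (y := b) hvB).2 h1
    have := projRank_mono σ B h2.le
    omega
  · have h3 := projRank_mono σ B h1.le
    have h4 := projRank_mono σ B h2.le
    exact absurd (hσ.2 v hv hvB (by omega) a ha) h2.not_gt

/-- For neighbours in value within `H` no element lies between them in both senses: members of `H`
are excluded by value, all others by position. Each such exchange costs exactly one factor `φ`. -/
theorem lastSum_blockSet {n : ℕ} (φ : ℝ) {B H : Finset (Fin n)} (hBH : Disjoint B H) (m : ℕ)
    {a b : Fin n} (ha : a ∈ H) (hb : b ∈ H) (hab : a < b) :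
    lastSum φ (blockSet B H m) H a
      = φ ^ ((openPart H a b).card + 1) * lastSum φ (blockSet B H m) H b := by
  have key := rel_of_rel_adjacent φ (· = ·) (fun x y z => Eq.trans)
    (fun k x y h => congrArg _ h) (Finset.disjoint_empty_right H)
    (fun a => lastSum φ (blockSet B H m) H a) ?_ a ha b hb hab
  · simpa [openPart] using key
  · intro a ha b hb hab he
    refine lastSum_eq_of_card_eq φ ha hb hab
      (fun σ hσ => mul_swap_mem_blockSet hBH ha hb hσ) _ fun σ hσ _ => ?_
    have : betweenSet σ a b = ∅ := by
      rw [Finset.eq_empty_iff_forall_notMem]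
      intro z hz
      simp only [betweenSet, mem_filter, mem_univ, true_and] at hz
      by_cases hzH : z ∈ H
      · have : z ∈ openPart H a b := mem_openPart.2 ⟨hzH, hz.1⟩
        rw [he] at this
        simp at this
      · exact not_between_of_mem_blockSet hσ ha hb hzH hz.2
    rw [this]
    simp [openPart]

/-- Describes the pair condition symmetrically in `u` and `w`, except for which one ends the block,
so that `lastSum_blockSet` compares the two orders. -/
theorem pairSet_eq_filter_blockSet {n : ℕ} {A E : Finset (Fin n)} {u w : Fin n} (hu : u ∈ A)
    (hw : w ∈ A) (huw : u ≠ w) (hE : Disjoint E A) (m : ℕ) :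
    pairSet A u w (m + 1) E
      = (blockSet (A \ {u, w}) (E ∪ {u, w}) m).filter fun σ =>
        ∀ z ∈ E ∪ {u, w}, σ z ≤ σ w := by
  ext σ
  rw [mem_filter, mem_pairSet, mem_blockSet]
  have hr := projRank_sdiff_pair σ hu hw huw
  have hne : σ u ≠ σ w := σ.injective.ne huw
  have huH : u ∈ E ∪ {u, w} := by simp
  have hwH : w ∈ E ∪ {u, w} := by simp
  constructor
  · rintro ⟨h1, h2, rfl⟩
    have huw' : σ u < σ w := (projRank_lt_iff σ A hw).1 (by omega)
    have hu' : projRank σ (A \ {u, w}) u = m := by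
      have := hr u
      rw [if_pos le_rfl, if_neg huw'.not_ge] at this
      omega
    have hw' : projRank σ (A \ {u, w}) w = m := by
      have := hr w
      rw [if_pos le_rfl, if_pos huw'.le] at this
      omega
    have hgap : ∀ v ∈ gapSet σ A (m + 1), σ v < σ w ∧ projRank σ (A \ {u, w}) v = m := by
      intro v hv
      rw [mem_gapSet] at hv
      have hvw : σ v < σ w := (projRank_lt_iff σ A hw).1 (by omega)
      refine ⟨hvw, ?_⟩
      have h3 := hr v
      rw [if_neg hvw.not_ge] at h3
      by_cases h4 : σ u ≤ σ v
      · have := projRank_mono σ A h4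
        rw [if_pos h4] at h3
        omega
      · have := projRank_mono σ (A \ {u, w}) (not_le.1 h4).le
        rw [if_neg h4] at h3
        omega
    refine ⟨⟨?_, ?_⟩, ?_⟩
    · intro h hh
      simp only [mem_union, mem_insert, mem_singleton] at hh
      rcases hh with hh | rfl | rfl
      exacts [(hgap h hh).2, hu', hw']
    · intro v hvH hvB hv h hh
      have hhw : σ h ≤ σ w := by
        simp only [mem_union, mem_insert, mem_singleton] at hh
        rcases hh with hh | rfl | rfl
        exacts [(hgap h hh).1.le, huw'.le, le_rfl]
      -- Otherwise `v` would precede `w` and hence belong to the gap set.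
      refine lt_of_le_of_lt hhw (not_le.1 fun hvw => hvH ?_)
      simp only [mem_union, mem_insert, mem_singleton, not_or, mem_sdiff, not_and, not_not]
        at hvH hvB ⊢
      have hvw' : σ v < σ w := lt_of_le_of_ne hvw (σ.injective.ne hvH.2.2)
      refine Or.inl (mem_gapSet.2 ⟨fun hvA => ?_, ?_⟩)
      · exact hvH.2.2 (hvB hvA hvH.2.1)
      · have h3 := hr v
        rw [if_neg hvw'.not_ge, hv] at h3
        split_ifs at h3 <;> omega
    · intro z hz
      simp only [mem_union, mem_insert, mem_singleton] at hz
      rcases hz with hz | rfl | rfl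
      exacts [(hgap z hz).1.le, huw'.le, le_rfl]
  · rintro ⟨⟨h1, h2⟩, h3⟩
    have huw' : σ u < σ w := lt_of_le_of_ne (h3 u huH) hne
    have hu' : projRank σ A u = m + 1 := by
      rw [hr, h1 u huH, if_pos le_rfl, if_neg huw'.not_ge]
    have hw' : projRank σ A w = m + 1 + 1 := by
      rw [hr, h1 w hwH, if_pos le_rfl, if_pos huw'.le]
    refine ⟨hu', hw', ?_⟩
    ext v
    rw [mem_gapSet]
    constructor
    · rintro ⟨hvA, hv⟩
      have hvw : σ v < σ w := (projRank_lt_iff σ A hw).1 (by omega)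
      have hvm : projRank σ (A \ {u, w}) v = m := by
        have h4 := hr v
        rw [if_neg hvw.not_ge] at h4
        by_cases h5 : σ u ≤ σ v
        · have := projRank_mono σ A h5
          rw [if_pos h5] at h4
          omega
        · have := projRank_mono σ (A \ {u, w}) (not_le.1 h5).le
          rw [if_neg h5] at h4
          have := h1 u huH
          omega
      by_contra hvE
      refine absurd (h2 v ?_ ?_ hvm w hwH) hvw.not_gt
      · simp only [mem_union, mem_insert, mem_singleton, not_or]
        exact ⟨hvE, fun h => hvA (h ▸ hu), fun h => hvA (h ▸ hw)⟩
      · exact fun h => hvA (mem_sdiff.1 h).1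
    · intro hvE
      have hvA : v ∉ A := Finset.disjoint_left.1 hE hvE
      have hvH : v ∈ E ∪ {u, w} := mem_union_left _ hvE
      have hvw : σ v < σ w :=
        lt_of_le_of_ne (h3 v hvH) (σ.injective.ne fun h => hvA (h ▸ hw))
      refine ⟨hvA, ?_⟩
      rw [hr v, h1 v hvH, if_neg hvw.not_ge]
      split_ifs <;> omega

/-- The weight of a finite set of rankings. -/
noncomputable def weight {n : ℕ} (φ : ℝ) (X : Finset (Equiv.Perm (Fin n))) : ℝ :=
  ∑ σ ∈ X, φ ^ kendallTau 1 σ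

theorem weight_nonneg {n : ℕ} {φ : ℝ} (hφ : 0 ≤ φ) (X : Finset (Equiv.Perm (Fin n))) :
    0 ≤ weight φ X :=
  Finset.sum_nonneg fun _ _ => pow_nonneg hφ _

/-- Exchanging two elements `a < b` of consecutive ranks changes the weight by a factor which
depends only on the number of gap elements between them in value. -/
theorem weight_pairSet_swap {n : ℕ} (φ : ℝ) {A E : Finset (Fin n)} {a b : Fin n} (ha : a ∈ A)
    (hb : b ∈ A) (hab : a < b) (hE : Disjoint E A) (m : ℕ) :
    weight φ (pairSet A b a (m + 1) E)
      = φ ^ ((openPart E a b).card + 1) * weight φ (pairSet A a b (m + 1) E) := by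
  have hdisj : Disjoint (A \ {a, b}) (E ∪ {a, b}) := by
    rw [Finset.disjoint_union_right]
    exact ⟨(hE.symm).mono_left sdiff_subset, disjoint_sdiff_self_left⟩
  have h := lastSum_blockSet φ hdisj m (a := a) (b := b) (by simp) (by simp) hab
  have ho : openPart (E ∪ {a, b}) a b = openPart E a b := by
    ext z
    simp only [mem_openPart, mem_union, mem_insert, mem_singleton]
    constructor
    · rintro ⟨h1 | rfl | rfl, h2, h3⟩
      · exact ⟨h1, h2, h3⟩
      · exact absurd h2 (lt_irrefl _)
      · exact absurd h3 (lt_irrefl _)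
    · exact fun h => ⟨Or.inl h.1, h.2⟩
  rw [ho] at h
  rw [pairSet_eq_filter_blockSet ha hb hab.ne hE, pairSet_eq_filter_blockSet hb ha hab.ne' hE,
    Finset.pair_comm b a]
  exact h

/-! ### Decomposition by neighbouring element and gap set -/

theorem exists_projRank_eq {n : ℕ} (σ : Equiv.Perm (Fin n)) {A : Finset (Fin n)} {k : ℕ}
    (h1 : 1 ≤ k) (h2 : k ≤ A.card) : ∃ y ∈ A, projRank σ A y = k := by
  obtain ⟨y, hy, h⟩ := (projRank_bijOn σ A).surjOn (by simp [h1, h2] : k ∈ _)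
  exact ⟨y, hy, h⟩

theorem projRank_inj {n : ℕ} (σ : Equiv.Perm (Fin n)) {A : Finset (Fin n)} {x y : Fin n}
    (hx : x ∈ A) (hy : y ∈ A) (h : projRank σ A x = projRank σ A y) : x = y :=
  (projRank_bijOn σ A).injOn hx hy h

theorem weight_eq_sum_rank_gap {n : ℕ} (φ : ℝ) {A : Finset (Fin n)} {u : Fin n} {k : ℕ} (j : ℕ)
    (h1 : 1 ≤ k) (h2 : k ≤ A.card) (X : Finset (Equiv.Perm (Fin n)))
    (hX : ∀ σ ∈ X, projRank σ A u ≠ k) :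
    weight φ X = ∑ E ∈ Aᶜ.powerset, ∑ y ∈ A.erase u,
      weight φ (X.filter fun σ => projRank σ A y = k ∧ gapSet σ A j = E) := by
  have hg : ∀ σ ∈ X, gapSet σ A j ∈ Aᶜ.powerset := by
    intro σ _
    rw [mem_powerset]
    intro v hv
    exact mem_compl.2 (mem_gapSet.1 hv).1
  unfold weight
  rw [← Finset.sum_fiberwise_of_maps_to hg]
  refine Finset.sum_congr rfl fun E _ => ?_
  simp_rw [Finset.sum_filter]
  rw [Finset.sum_comm]
  refine Finset.sum_congr rfl fun σ hσ => ?_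
  obtain ⟨y, hy, hyk⟩ := exists_projRank_eq σ h1 h2
  have hyu : y ≠ u := fun h => hX σ hσ (h ▸ hyk)
  rw [Finset.sum_eq_single y]
  · simp [hyk]
  · intro z hz hzy
    rw [if_neg]
    rintro ⟨h, _⟩
    exact hzy (projRank_inj σ (mem_erase.1 hz).2 hy (h.trans hyk.symm))
  · exact fun h => absurd (mem_erase.2 ⟨hyu, hy⟩) h

/-- The rankings in which `u` has rank `j` in `A`. -/
def rankSet {n : ℕ} (A : Finset (Fin n)) (u : Fin n) (j : ℕ) : Finset (Equiv.Perm (Fin n)) :=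
  univ.filter fun σ => projRank σ A u = j

theorem mem_rankSet {n : ℕ} {A : Finset (Fin n)} {u : Fin n} {j : ℕ} {σ : Equiv.Perm (Fin n)} :
    σ ∈ rankSet A u j ↔ projRank σ A u = j := by
  simp [rankSet]

theorem weight_rankSet {n : ℕ} (φ : ℝ) {A : Finset (Fin n)} (u : Fin n) {j : ℕ}
    (h2 : j < A.card) :
    weight φ (rankSet A u j)
      = ∑ E ∈ Aᶜ.powerset, ∑ y ∈ A.erase u, weight φ (pairSet A u y j E) := by
  rw [weight_eq_sum_rank_gap φ (k := j + 1) j (by omega) h2 _ (u := u)]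
  · refine Finset.sum_congr rfl fun E _ => Finset.sum_congr rfl fun y _ => ?_
    congr 1
    ext σ
    rw [mem_filter, mem_rankSet, mem_pairSet]
  · intro σ hσ
    rw [mem_rankSet] at hσ
    omega

theorem weight_rankSet_succ {n : ℕ} (φ : ℝ) {A : Finset (Fin n)} (u : Fin n) {j : ℕ}
    (h1 : 1 ≤ j) (h2 : j < A.card) :
    weight φ (rankSet A u (j + 1))
      = ∑ E ∈ Aᶜ.powerset, ∑ y ∈ A.erase u, weight φ (pairSet A y u j E) := by
  rw [weight_eq_sum_rank_gap φ (k := j) j h1 h2.le _ (u := u)]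
  · refine Finset.sum_congr rfl fun E _ => Finset.sum_congr rfl fun y _ => ?_
    congr 1
    ext σ
    rw [mem_filter, mem_rankSet, mem_pairSet]
    tauto
  · intro σ hσ
    rw [mem_rankSet] at hσ
    omega

/-! ### Classes with fixed gap set and prefix set -/

/-- The elements of `A` other than `u` of rank at most `j + 1`. -/
def prefixSet {n : ℕ} (σ : Equiv.Perm (Fin n)) (A : Finset (Fin n)) (u : Fin n) (j : ℕ) :
    Finset (Fin n) :=
  (A.erase u).filter fun y => projRank σ A y ≤ j + 1

theorem mem_prefixSet {n : ℕ} {σ : Equiv.Perm (Fin n)} {A : Finset (Fin n)} {u : Fin n} {j : ℕ}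
    {y : Fin n} :
    y ∈ prefixSet σ A u j ↔ (y ≠ u ∧ y ∈ A) ∧ projRank σ A y ≤ j + 1 := by
  simp [prefixSet]

/-- The rankings in which `u` has rank `j` in `A`, with gap set `E` and prefix set `J`. -/
def classSet {n : ℕ} (A : Finset (Fin n)) (u : Fin n) (j : ℕ) (E J : Finset (Fin n)) :
    Finset (Equiv.Perm (Fin n)) :=
  univ.filter fun σ => projRank σ A u = j ∧ gapSet σ A j = E ∧ prefixSet σ A u j = J

theorem mem_classSet {n : ℕ} {A : Finset (Fin n)} {u : Fin n} {j : ℕ} {E J : Finset (Fin n)}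
    {σ : Equiv.Perm (Fin n)} :
    σ ∈ classSet A u j E J
      ↔ projRank σ A u = j ∧ gapSet σ A j = E ∧ prefixSet σ A u j = J := by
  simp [classSet]

theorem mul_swap_mem_classSet {n : ℕ} {A : Finset (Fin n)} {u : Fin n} {j : ℕ}
    {E J : Finset (Fin n)} (hJ : J ⊆ A.erase u) {a b : Fin n} (ha : a ∈ J) (hb : b ∈ J)
    {σ : Equiv.Perm (Fin n)} (hσ : σ ∈ classSet A u j E J) :
    σ * Equiv.swap a b ∈ classSet A u j E J := by
  have haA := mem_erase.1 (hJ ha)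
  have hbA := mem_erase.1 (hJ hb)
  have hr := projRank_mul_swap σ A (a := a) (b := b) (by simp [haA.2, hbA.2])
  rw [mem_classSet] at hσ ⊢
  obtain ⟨h1, h2, h3⟩ := hσ
  refine ⟨?_, ?_, ?_⟩
  · rw [hr, Equiv.swap_apply_of_ne_of_ne haA.1.symm hbA.1.symm, h1]
  · rw [← h2]
    ext v
    rw [mem_gapSet, mem_gapSet]
    refine and_congr_right fun hv => ?_
    rw [hr, Equiv.swap_apply_of_ne_of_ne] <;> rintro rfl
    exacts [hv haA.2, hv hbA.2]
  · ext y
    rw [← swap_mem_iff ha hb, ← h3, mem_prefixSet, mem_prefixSet, hr]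
    have := swap_mem_iff (mem_erase.2 haA) (mem_erase.2 hbA) y
    rw [mem_erase, mem_erase] at this
    rw [this]

/-- The last element of the prefix set is the one of rank `j + 1`, since `u` itself holds rank `j`.
-/
theorem mem_class_last_iff {n : ℕ} {A : Finset (Fin n)} {u y : Fin n} {j : ℕ}
    {E J : Finset (Fin n)} (hj : j < A.card) (hy : y ∈ J) {σ : Equiv.Perm (Fin n)} :
    (σ ∈ classSet A u j E J ∧ ∀ z ∈ J, σ z ≤ σ y)
      ↔ σ ∈ pairSet A u y j E ∧ prefixSet σ A u j = J := by
  rw [mem_classSet, mem_pairSet]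
  constructor
  · rintro ⟨⟨h1, h2, rfl⟩, h3⟩
    obtain ⟨w, hwA, hw⟩ := exists_projRank_eq σ (A := A) (k := j + 1) (by omega) hj
    have hwJ : w ∈ prefixSet σ A u j := by
      refine mem_prefixSet.2 ⟨⟨?_, hwA⟩, hw.le⟩
      rintro rfl
      omega
    have h4 := projRank_mono σ A (h3 w hwJ)
    have h5 := (mem_prefixSet.1 hy).2
    exact ⟨⟨h1, by omega, h2⟩, rfl⟩
  · rintro ⟨⟨h1, h2, h3⟩, rfl⟩
    refine ⟨⟨h1, h3, rfl⟩, fun z hz => ?_⟩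
    rw [mem_prefixSet] at hz
    by_contra h
    have := (projRank_lt_iff σ A (x := z) (y := y) hz.1.2).2 (not_le.1 h)
    omega

theorem weight_pairSet_eq_sum {n : ℕ} (φ : ℝ) {A : Finset (Fin n)} {u y : Fin n} {j : ℕ}
    (E : Finset (Fin n)) (hj : j < A.card) (hy : y ∈ A.erase u) :
    weight φ (pairSet A u y j E)
      = ∑ J ∈ (A.erase u).powerset,
        if y ∈ J then lastSum φ (classSet A u j E J) J y else 0 := by
  have hm : ∀ σ ∈ pairSet A u y j E, prefixSet σ A u j ∈ (A.erase u).powerset :=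
    fun σ _ => mem_powerset.2 (filter_subset _ _)
  unfold weight
  rw [← Finset.sum_fiberwise_of_maps_to hm]
  refine Finset.sum_congr rfl fun J _ => ?_
  split_ifs with h
  · unfold lastSum
    congr 1
    ext σ
    rw [mem_filter, mem_filter, mem_class_last_iff hj h]
  · refine Finset.sum_eq_zero fun σ hσ => absurd ?_ h
    rw [mem_filter, mem_pairSet] at hσ
    rw [← hσ.2, mem_prefixSet]
    exact ⟨mem_erase.1 hy, hσ.1.2.1.le⟩

/-- In a ranking of a class, `u` and the gap set are placed between the last element of `J` and
the other elements of `J`. -/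
theorem between_of_mem_classSet {n : ℕ} {A : Finset (Fin n)} {u : Fin n} {j : ℕ}
    {E J : Finset (Fin n)} (hu : u ∈ A) (hj : j < A.card) {σ : Equiv.Perm (Fin n)}
    (hσ : σ ∈ classSet A u j E J) {a b z : Fin n} (ha : a ∈ J) (hlast : ∀ z ∈ J, σ z ≤ σ a)
    (hb : b ∈ J) (hab : a ≠ b) (hz : z ∈ insert u E) : σ b < σ z ∧ σ z < σ a := by
  have hp := ((mem_class_last_iff hj ha).1 ⟨hσ, hlast⟩).1
  rw [mem_pairSet] at hp
  obtain ⟨h1, h2, rfl⟩ := hp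
  rw [mem_classSet] at hσ
  obtain ⟨-, -, rfl⟩ := hσ
  rw [mem_prefixSet] at ha hb
  have hb1 : projRank σ A b ≠ j + 1 := fun h =>
    hab (projRank_inj σ ha.1.2 hb.1.2 (h2.trans h.symm))
  have hb2 : projRank σ A b ≠ j := fun h =>
    hb.1.1 (projRank_inj σ hb.1.2 hu (h.trans h1.symm))
  rw [mem_insert, mem_gapSet] at hz
  rcases hz with rfl | ⟨hzA, hz⟩
  · exact ⟨(projRank_lt_iff σ A hu).1 (by omega), (projRank_lt_iff σ A ha.1.2).1 (by omega)⟩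
  · refine ⟨?_, (projRank_lt_iff σ A ha.1.2).1 (by omega)⟩
    have hzb : z ≠ b := fun h => hzA (h ▸ hb.1.2)
    by_contra h
    have := (projRank_lt_iff σ A hb.1.2).2
      (lt_of_le_of_ne (not_lt.1 h) (σ.injective.ne hzb))
    omega

/-- When `a` is last in `J`, all of `u` and `E` lie in position between `b` and `a`, so each of them
with value in between saves two inversions. Chaining through the members of `J`, rather than
exchanging once, gains the further factor counted by `openPart J a b`. -/
theorem lastSum_classSet_le {n : ℕ} {φ : ℝ} (hφ0 : 0 ≤ φ) (hφ1 : φ ≤ 1) {A : Finset (Fin n)}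
    {u : Fin n} {j : ℕ} {E J : Finset (Fin n)} (hu : u ∈ A) (hj : j < A.card)
    (hE : Disjoint E A) (hJ : J ⊆ A.erase u) {a b : Fin n} (ha : a ∈ J) (hb : b ∈ J)
    (hab : a < b) :
    lastSum φ (classSet A u j E J) J a
      ≤ φ ^ ((openPart J a b).card + 1 + 2 * (openPart (insert u E) a b).card)
        * lastSum φ (classSet A u j E J) J b := by
  have hd : Disjoint J (insert u E) := by
    rw [Finset.disjoint_left]
    intro z hz hz'
    have h := mem_erase.1 (hJ hz)
    rcases mem_insert.1 hz' with rfl | hz'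
    exacts [h.1 rfl, Finset.disjoint_left.1 hE hz' h.2]
  refine rel_of_rel_adjacent φ (· ≤ ·) (fun x y z => le_trans)
    (fun k x y h => mul_le_mul_of_nonneg_left h (pow_nonneg hφ0 k)) hd
    (fun a => lastSum φ (classSet A u j E J) J a) ?_ a ha b hb hab
  intro a ha b hb hab _
  refine lastSum_le_of_le_card hφ0 hφ1 ha hb hab
    (fun σ hσ => mul_swap_mem_classSet hJ ha hb hσ) _ fun σ hσ hlast => ?_
  refine Finset.card_le_card fun z hz => ?_
  rw [mem_openPart] at hz
  simp only [betweenSet, mem_filter, mem_univ, true_and]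
  exact ⟨hz.2, between_of_mem_classSet hu hj hσ ha hlast hb hab.ne hz.1⟩

/-- In a nonempty class, `J` contains an element above `u` as soon as the rank of `u` in `A` is
at most `j`. -/
theorem exists_gt_of_classSet_nonempty {n : ℕ} {A : Finset (Fin n)} {u : Fin n} {j : ℕ}
    {E J : Finset (Fin n)} (hj : j < A.card) (hr : projRank 1 A u ≤ j)
    (hne : (classSet A u j E J).Nonempty) : ∃ x ∈ J, u < x := by
  obtain ⟨σ, hσ⟩ := hne
  rw [mem_classSet] at hσ
  obtain ⟨h1, -, rfl⟩ := hσ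
  by_contra! hcon
  -- If no member of `J` exceeded `u`, the `j + 1` elements of rank at most `j + 1` would all be at
  -- most `u`, too many for its centroid rank.
  have hsub : A.filter (fun y => projRank σ A y ≤ j + 1)
      ⊆ A.filter fun y => (1 : Equiv.Perm (Fin n)) y ≤ (1 : Equiv.Perm (Fin n)) u := by
    intro y hy
    rw [mem_filter] at hy ⊢
    refine ⟨hy.1, ?_⟩
    by_cases hyu : y = u
    · rw [hyu]
    · exact hcon y (mem_prefixSet.2 ⟨⟨hyu, hy.1⟩, hy.2⟩)
  have hcard : (A.filter fun y => projRank σ A y ≤ j + 1).card = j + 1 := by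
    obtain ⟨w, hwA, hw⟩ := exists_projRank_eq σ (A := A) (k := j + 1) (by omega) hj
    rw [← hw]
    unfold projRank
    congr 1
    ext y
    rw [mem_filter, mem_filter]
    refine and_congr_right fun hy => ?_
    have := projRank_lt_iff σ A (x := y) (y := w) hy
    rw [← not_lt, ← not_lt (a := σ w), ← this]
    rfl
  have := Finset.card_le_card hsub
  rw [hcard] at this
  unfold projRank at hr
  omega

/-! ### Geometric sums and the main inequality -/

/-- The geometric sum `1 + φ + ⋯ + φ ^ (k - 1)`. -/
noncomputable def geomSum (φ : ℝ) (k : ℕ) : ℝ := ∑ i ∈ range k, φ ^ i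

theorem geomSum_nonneg {φ : ℝ} (hφ : 0 ≤ φ) (k : ℕ) : 0 ≤ geomSum φ k :=
  Finset.sum_nonneg fun _ _ => pow_nonneg hφ _

theorem geomSum_mono {φ : ℝ} (hφ : 0 ≤ φ) {k l : ℕ} (h : k ≤ l) :
    geomSum φ k ≤ geomSum φ l :=
  Finset.sum_le_sum_of_subset_of_nonneg (range_subset_range.2 h) fun _ _ _ => pow_nonneg hφ _

/-- Listed downwards, the elements have `0, 1, 2, …` larger ones. -/
theorem sum_pow_card_gt {α : Type*} [LinearOrder α] (φ : ℝ) (L : Finset α) :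
    ∑ y ∈ L, φ ^ (L.filter fun z => y < z).card = geomSum φ L.card := by
  induction L using Finset.induction_on_min with
  | empty => simp [geomSum]
  | insert a s ha ih =>
    have has : a ∉ s := fun h => lt_irrefl _ (ha a h)
    rw [Finset.sum_insert has, Finset.card_insert_of_notMem has, geomSum, Finset.sum_range_succ,
      ← geomSum, ← ih, add_comm]
    congr 1
    · refine Finset.sum_congr rfl fun y hy => ?_
      rw [Finset.filter_insert, if_neg (ha y hy).not_gt]
    · rw [Finset.filter_insert, if_neg (lt_irrefl a), Finset.filter_true_of_mem ha]

/-- Hypothesis `h` rearranges to `(φ^(l+2) - M φ^(2l+3)) * geomSum φ (n-l-2) ≤ M - φ`. A single `g`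
for all `l` is needed because the elements below `u` may have different numbers `l` of gap elements
between them and `u`. -/
theorem exists_uniform_bound {φ M : ℝ} (hφ0 : 0 < φ) (hφ1 : φ ≤ 1) (hM : φ ≤ M) {n b k : ℕ}
    (hk : k + b + 2 ≤ n)
    (h : ∀ l ≤ b, φ + φ ^ (l + 2) * geomSum φ (n - l - 2)
      ≤ M * (1 + φ ^ (2 * l + 3) * geomSum φ (n - l - 2))) :
    ∃ g, 0 ≤ g ∧ g * geomSum φ k ≤ M - φ ∧ ∀ l ≤ b, φ ^ (l + 2) - M * φ ^ (2 * l + 3) ≤ g := by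
  rcases Nat.eq_zero_or_pos k with rfl | hk0
  · refine ⟨1, zero_le_one, by simpa [geomSum] using hM, fun l _ => ?_⟩
    have h1 : φ ^ (l + 2) ≤ 1 := pow_le_one₀ hφ0.le hφ1
    have h2 : 0 ≤ M * φ ^ (2 * l + 3) := mul_nonneg (hφ0.le.trans hM) (pow_nonneg hφ0.le _)
    linarith
  · have hg : 0 < geomSum φ k := by
      unfold geomSum
      exact Finset.sum_pos (fun _ _ => pow_pos hφ0 _) ⟨0, mem_range.2 hk0⟩
    refine ⟨(M - φ) / geomSum φ k, div_nonneg (by linarith) hg.le,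
      (div_mul_cancel₀ _ hg.ne').le, fun l hl => ?_⟩
    rw [le_div_iff₀ hg]
    -- A negative coefficient is harmless as `M - φ ≥ 0`; for a nonnegative one, `k` may be enlarged
    -- to `n - l - 2`.
    rcases le_total (φ ^ (l + 2) - M * φ ^ (2 * l + 3)) 0 with h0 | h0
    · have := mul_nonpos_of_nonpos_of_nonneg h0 hg.le
      linarith
    · have h1 := mul_le_mul_of_nonneg_left
        (geomSum_mono hφ0.le (show k ≤ n - l - 2 by omega)) h0
      have h2 := h l hl
      nlinarith

/-- The factor between the weights of the two orders of a pair with gap set `E`. -/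
noncomputable def swapFactor {n : ℕ} (φ : ℝ) (E : Finset (Fin n)) (u y : Fin n) : ℝ :=
  if y < u then (φ ^ ((openPart E y u).card + 1))⁻¹ else φ

theorem weight_pairSet_le {n : ℕ} {φ : ℝ} (hφ0 : 0 < φ) (hφ1 : φ ≤ 1) {A E : Finset (Fin n)}
    {u y : Fin n} (hu : u ∈ A) (hy : y ∈ A.erase u) (hE : Disjoint E A) {j : ℕ} (hj : 1 ≤ j) :
    weight φ (pairSet A y u j E) ≤ swapFactor φ E u y * weight φ (pairSet A u y j E) := by
  obtain ⟨m, rfl⟩ := Nat.exists_eq_add_of_le' hj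
  rw [mem_erase] at hy
  unfold swapFactor
  split_ifs with h
  · rw [weight_pairSet_swap φ hy.2 hu h hE, inv_mul_cancel_left₀ (pow_pos hφ0 _).ne']
  · rw [weight_pairSet_swap φ hu hy.2 (lt_of_le_of_ne (not_lt.1 h) hy.1.symm) hE, pow_succ]
    refine mul_le_mul_of_nonneg_right ?_ (weight_nonneg hφ0.le _)
    exact mul_le_of_le_one_left hφ0.le (pow_le_one₀ hφ0.le hφ1)

/-- The heart of the proof: within a class, the excess over `M` of the terms below `u` is paid for
by the deficit `M - φ` of the largest element of `J`. -/
theorem sum_swapFactor_mul_lastSum_le {n : ℕ} {φ M : ℝ} (hφ0 : 0 < φ) (hφ1 : φ ≤ 1)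
    (hM : φ ≤ M) {A : Finset (Fin n)} {u : Fin n} {j : ℕ} {E J : Finset (Fin n)} (hu : u ∈ A)
    (hj : j < A.card) (hr : projRank 1 A u ≤ j) (hE : E ⊆ Aᶜ) (hJ : J ⊆ A.erase u)
    (h : ∀ l ≤ n - A.card, φ + φ ^ (l + 2) * geomSum φ (n - l - 2)
      ≤ M * (1 + φ ^ (2 * l + 3) * geomSum φ (n - l - 2))) :
    ∑ y ∈ J, swapFactor φ E u y * lastSum φ (classSet A u j E J) J y
      ≤ M * ∑ y ∈ J, lastSum φ (classSet A u j E J) J y := by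
  have hEA : Disjoint E A := Finset.disjoint_left.2 fun z hz => mem_compl.1 (hE hz)
  rcases (classSet A u j E J).eq_empty_or_nonempty with he | hne
  · simp [he, lastSum]
  obtain ⟨x₀, hx₀J, hx₀⟩ := exists_gt_of_classSet_nonempty hj hr hne
  have hJne : J.Nonempty := ⟨x₀, hx₀J⟩
  set x := J.max' hJne with hx
  have hxJ : x ∈ J := J.max'_mem hJne
  have hux : u < x := hx₀.trans_le (J.le_max' _ hx₀J)
  set T : Fin n → ℝ := fun y => lastSum φ (classSet A u j E J) J y with hT
  have hT0 : ∀ y, 0 ≤ T y := fun y => lastSum_nonneg hφ0.le _ _ _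
  set L := J.filter fun y => y < u with hL
  have hLcard : L.card + (n - A.card) + 2 ≤ n := by
    have h1 : L ⊆ (A.erase u).erase x := by
      intro z hz
      rw [mem_filter] at hz
      exact mem_erase.2 ⟨(hz.2.trans hux).ne, hJ hz.1⟩
    have h2 := Finset.card_le_card h1
    rw [Finset.card_erase_of_mem (hJ hxJ), Finset.card_erase_of_mem hu] at h2
    have h3 : 1 < A.card := Finset.one_lt_card.2 ⟨u, hu, x, (mem_erase.1 (hJ hxJ)).2, hux.ne⟩
    have h4 := Finset.card_le_univ A
    rw [Fintype.card_fin] at h4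
    omega
  obtain ⟨g, hg0, hgM, hg⟩ := exists_uniform_bound hφ0 hφ1 hM hLcard h
  have hlow : ∀ y ∈ L, (swapFactor φ E u y - M) * T y
      ≤ φ ^ (L.filter fun z => y < z).card * (g * T x) := by
    intro y hy
    obtain ⟨hyJ, hyu⟩ := mem_filter.1 hy
    set m := (openPart E y u).card with hm
    set i := (L.filter fun z => y < z).card with hi
    have hc : swapFactor φ E u y = (φ ^ (m + 1))⁻¹ := if_pos hyu
    have hmb : m ≤ n - A.card := by
      have h1 : openPart E y u ⊆ Aᶜ := (filter_subset _ _).trans hE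
      have h2 := Finset.card_le_card h1
      rwa [Finset.card_compl, Fintype.card_fin] at h2
    -- The exponent is `i + 1 + 2 * (m + 1)`: `u` lies between `y` and `x` together with the `m` gap
    -- elements, and `i` counts members of `J` only below `u`.
    have hTy : T y ≤ φ ^ (i + 3 + 2 * m) * T x := by
      refine (lastSum_classSet_le hφ0.le hφ1 hu hj hEA hJ hyJ hxJ (hyu.trans hux)).trans
        (mul_le_mul_of_nonneg_right (pow_le_pow_of_le_one hφ0.le hφ1 ?_) (hT0 x))
      have h1 : i ≤ (openPart J y x).card := by
        refine Finset.card_le_card fun z hz => ?_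
        rw [mem_filter, mem_filter] at hz
        exact mem_openPart.2 ⟨hz.1.1, hz.2, hz.1.2.trans hux⟩
      have h2 : m + 1 ≤ (openPart (insert u E) y x).card := by
        have h3 : u ∉ openPart E y u := fun h => lt_irrefl _ (mem_openPart.1 h).2.2
        rw [hm, ← Finset.card_insert_of_notMem h3]
        refine Finset.card_le_card fun z hz => ?_
        rw [mem_openPart]
        rcases mem_insert.1 hz with rfl | hz
        · exact ⟨mem_insert_self _ _, hyu, hux⟩
        · rw [mem_openPart] at hz
          exact ⟨mem_insert_of_mem hz.1, hz.2.1, hz.2.2.trans hux⟩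
      omega
    rcases le_total (swapFactor φ E u y) M with hcM | hcM
    · exact (mul_nonpos_of_nonpos_of_nonneg (sub_nonpos.2 hcM) (hT0 y)).trans
        (mul_nonneg (pow_nonneg hφ0.le _) (mul_nonneg hg0 (hT0 x)))
    · refine (mul_le_mul_of_nonneg_left hTy (sub_nonneg.2 hcM)).trans ?_
      have h1 : (swapFactor φ E u y - M) * (φ ^ (i + 3 + 2 * m) * T x)
          = φ ^ i * ((φ ^ (m + 2) - M * φ ^ (2 * m + 3)) * T x) := by
        rw [hc]
        have : φ ^ (m + 1) ≠ 0 := (pow_pos hφ0 _).ne'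
        field_simp
        ring
      rw [h1]
      exact mul_le_mul_of_nonneg_left (mul_le_mul_of_nonneg_right (hg m hmb) (hT0 x))
        (pow_nonneg hφ0.le _)
  have hlow' : ∑ y ∈ L, (swapFactor φ E u y - M) * T y ≤ (M - φ) * T x := by
    refine (Finset.sum_le_sum hlow).trans ?_
    rw [← Finset.sum_mul, sum_pow_card_gt, ← mul_assoc, mul_comm (geomSum φ L.card)]
    exact mul_le_mul_of_nonneg_right hgM (hT0 x)
  -- Every term here is nonpositive, so keeping only `x` gives an upper bound.
  have hhigh : ∑ y ∈ J.filter (fun y => ¬ y < u), (swapFactor φ E u y - M) * T y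
      ≤ (φ - M) * T x := by
    have h1 : ∀ y ∈ J.filter (fun y => ¬ y < u),
        (swapFactor φ E u y - M) * T y = (φ - M) * T y := by
      intro y hy
      rw [swapFactor, if_neg (mem_filter.1 hy).2]
    rw [Finset.sum_congr rfl h1, ← Finset.mul_sum]
    refine mul_le_mul_of_nonpos_left ?_ (sub_nonpos.2 hM)
    exact Finset.single_le_sum (fun y _ => hT0 y) (mem_filter.2 ⟨hxJ, hux.not_gt⟩)
  have hsplit := Finset.sum_filter_add_sum_filter_not J (fun y => y < u)
    fun y => (swapFactor φ E u y - M) * T y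
  have hfin : ∑ y ∈ J, (swapFactor φ E u y - M) * T y ≤ 0 := by
    rw [← hsplit]
    linarith
  simp only [sub_mul, Finset.sum_sub_distrib, ← Finset.mul_sum] at hfin
  linarith

/-- Sums the class estimate over all `E` and `J`; `h` says that `M` dominates every quotient, with
denominators cleared. -/
theorem weight_rankSet_succ_le {n : ℕ} {φ M : ℝ} (hφ0 : 0 < φ) (hφ1 : φ ≤ 1)
    (hM : φ ≤ M) {A : Finset (Fin n)} {u : Fin n} {j : ℕ} (hu : u ∈ A) (hj : j < A.card)
    (hr : projRank 1 A u ≤ j)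
    (h : ∀ l ≤ n - A.card, φ + φ ^ (l + 2) * geomSum φ (n - l - 2)
      ≤ M * (1 + φ ^ (2 * l + 3) * geomSum φ (n - l - 2))) :
    weight φ (rankSet A u (j + 1)) ≤ M * weight φ (rankSet A u j) := by
  have hj1 : 1 ≤ j := by
    refine le_trans ?_ hr
    exact Finset.card_pos.2 ⟨u, mem_filter.2 ⟨hu, le_rfl⟩⟩
  rw [weight_rankSet φ u hj, weight_rankSet_succ φ u hj1 hj, Finset.mul_sum]
  refine Finset.sum_le_sum fun E hE => ?_
  rw [mem_powerset] at hE
  have hEA : Disjoint E A := Finset.disjoint_left.2 fun z hz => mem_compl.1 (hE hz)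
  have hsum : ∀ f : Fin n → ℝ, ∑ y ∈ A.erase u, f y * weight φ (pairSet A u y j E)
      = ∑ J ∈ (A.erase u).powerset, ∑ y ∈ J, f y * lastSum φ (classSet A u j E J) J y := by
    intro f
    have h1 : ∀ y ∈ A.erase u, f y * weight φ (pairSet A u y j E)
        = ∑ J ∈ (A.erase u).powerset,
          if y ∈ J then f y * lastSum φ (classSet A u j E J) J y else 0 := by
      intro y hy
      rw [weight_pairSet_eq_sum φ E hj hy, Finset.mul_sum]
      exact Finset.sum_congr rfl fun J _ => by rw [mul_ite, mul_zero]
    rw [Finset.sum_congr rfl h1, Finset.sum_comm]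
    refine Finset.sum_congr rfl fun J hJ => ?_
    rw [← Finset.sum_filter, Finset.filter_mem_eq_inter,
      Finset.inter_eq_right.2 (mem_powerset.1 hJ)]
  refine (Finset.sum_le_sum fun y hy => weight_pairSet_le hφ0 hφ1 hu hy hEA hj1).trans ?_
  rw [hsum, Finset.mul_sum, hsum, Finset.sum_congr rfl fun J _ => (Finset.mul_sum _ _ _).symm]
  refine Finset.sum_le_sum fun J hJ => ?_
  exact sum_swapFactor_mul_lastSum_le hφ0 hφ1 hM hu hj hr hE (mem_powerset.1 hJ) h

/-! ### Reduction to the identity centroid, and reversal -/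

theorem projRank_map {n : ℕ} (σ₀ σ : Equiv.Perm (Fin n)) (A : Finset (Fin n)) (u : Fin n) :
    projRank (σ * σ₀⁻¹) (A.map σ₀.toEmbedding) (σ₀ u) = projRank σ A u := by
  unfold projRank
  symm
  refine Finset.card_equiv σ₀ fun y => ?_
  rw [mem_filter, mem_filter]
  simp

theorem kendallTau_eq_one_mul_inv {n : ℕ} (σ₀ σ : Equiv.Perm (Fin n)) :
    kendallTau σ₀ σ = kendallTau 1 (σ * σ₀⁻¹) := by
  unfold kendallTau
  refine Finset.card_equiv (σ₀.prodCongr σ₀) fun p => ?_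
  rw [mem_filter, mem_filter]
  simp

theorem probRankEq_eq_weight_div {n : ℕ} (σ₀ : Equiv.Perm (Fin n)) (φ : ℝ) (A : Finset (Fin n))
    (u : Fin n) (j : ℕ) :
    probRankEq σ₀ φ A u j
      = weight φ (rankSet (A.map σ₀.toEmbedding) (σ₀ u) j) / weight φ (n := n) univ := by
  unfold probRankEq mallowsMass
  rw [← Finset.sum_div]
  congr 1
  · refine Finset.sum_equiv (Equiv.mulRight σ₀⁻¹) (fun σ => ?_) (fun σ _ => ?_)
    · rw [mem_filter, mem_rankSet, Equiv.coe_mulRight, projRank_map]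
      simp
    · rw [Equiv.coe_mulRight, kendallTau_eq_one_mul_inv]
  · refine Finset.sum_equiv (Equiv.mulRight σ₀⁻¹) (fun σ => by simp) (fun σ _ => ?_)
    rw [Equiv.coe_mulRight, kendallTau_eq_one_mul_inv]

theorem kendallTau_rev {n : ℕ} (σ₀ σ : Equiv.Perm (Fin n)) :
    kendallTau (Fin.revPerm * σ₀) (Fin.revPerm * σ) = kendallTau σ₀ σ := by
  unfold kendallTau
  refine Finset.card_equiv (Equiv.prodComm _ _) fun p => ?_
  rw [mem_filter, mem_filter]
  simp

theorem projRank_rev_add {n : ℕ} (σ : Equiv.Perm (Fin n)) {A : Finset (Fin n)} {u : Fin n}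
    (hu : u ∈ A) : projRank (Fin.revPerm * σ) A u + projRank σ A u = A.card + 1 := by
  have h1 : projRank (Fin.revPerm * σ) A u = (A.filter fun y => σ u ≤ σ y).card := by
    unfold projRank
    simp
  have h2 : (A.filter fun y => σ u ≤ σ y) ∪ (A.filter fun y => σ y ≤ σ u) = A := by
    rw [← Finset.filter_or]
    exact Finset.filter_true_of_mem fun y _ => le_total _ _
  have h3 : (A.filter fun y => σ u ≤ σ y) ∩ (A.filter fun y => σ y ≤ σ u) = {u} := by
    ext y
    simp only [mem_inter, mem_filter, mem_singleton]
    constructor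
    · rintro ⟨⟨-, h⟩, -, h'⟩
      exact σ.injective (le_antisymm h' h)
    · rintro rfl
      exact ⟨⟨hu, le_rfl⟩, hu, le_rfl⟩
  have h4 := Finset.card_union_add_card_inter (A.filter fun y => σ u ≤ σ y)
    (A.filter fun y => σ y ≤ σ u)
  rw [h2, h3, Finset.card_singleton] at h4
  rw [h1]
  exact h4.symm

/-- Reversing all rankings reverses the law of the rank of `u`. -/
theorem probRankEq_rev {n : ℕ} (σ₀ : Equiv.Perm (Fin n)) (φ : ℝ) {A : Finset (Fin n)}
    {u : Fin n} (hu : u ∈ A) {i j : ℕ} (hij : i + j = A.card + 1) :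
    probRankEq (Fin.revPerm * σ₀) φ A u i = probRankEq σ₀ φ A u j := by
  have hmass : ∀ σ, mallowsMass (Fin.revPerm * σ₀) φ (Fin.revPerm * σ) = mallowsMass σ₀ φ σ := by
    intro σ
    unfold mallowsMass
    rw [kendallTau_rev]
    congr 1
    symm
    refine Finset.sum_equiv (Equiv.mulLeft Fin.revPerm) (fun σ => by simp) (fun σ _ => ?_)
    rw [Equiv.coe_mulLeft, kendallTau_rev]
  unfold probRankEq
  symm
  refine Finset.sum_equiv (Equiv.mulLeft Fin.revPerm) (fun σ => ?_) (fun σ _ => ?_)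
  · have := projRank_rev_add σ hu
    simp only [mem_filter, mem_univ, true_and, Equiv.coe_mulLeft]
    omega
  · rw [Equiv.coe_mulLeft, hmass]

theorem probRankEq_pos {n : ℕ} (σ₀ : Equiv.Perm (Fin n)) {φ : ℝ} (hφ : 0 < φ)
    {A : Finset (Fin n)} {u : Fin n} (hu : u ∈ A) {j : ℕ} (h1 : 1 ≤ j) (h2 : j ≤ A.card) :
    0 < probRankEq σ₀ φ A u j := by
  obtain ⟨y, hyA, hy⟩ := exists_projRank_eq (1 : Equiv.Perm (Fin n)) h1 h2
  refine Finset.sum_pos (fun σ _ => mallowsMass_pos σ₀ hφ σ) ⟨1 * Equiv.swap u y, ?_⟩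
  rw [mem_filter, projRank_mul_swap 1 A (by simp [hu, hyA]), Equiv.swap_apply_left]
  exact ⟨mem_univ _, hy⟩

/-! ### The quotients and the upper bound -/

theorem powSum_eq {φ : ℝ} (s t : ℕ) : powSum φ s t = φ ^ s * geomSum φ (t + 1 - s) := by
  unfold powSum geomSum
  rw [← Finset.Ico_add_one_right_eq_Icc, Finset.sum_Ico_eq_sum_range, Finset.mul_sum]
  exact Finset.sum_congr rfl fun i _ => pow_add _ _ _

theorem geomSum_succ (φ : ℝ) (k : ℕ) : geomSum φ (k + 1) = 1 + φ * geomSum φ k := by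
  unfold geomSum
  rw [Finset.sum_range_succ', Finset.mul_sum, pow_zero, add_comm]
  congr 1
  exact Finset.sum_congr rfl fun i _ => by rw [pow_succ, mul_comm]

theorem one_sub_mul_geomSum (φ : ℝ) (k : ℕ) : (1 - φ) * geomSum φ k = 1 - φ ^ k :=
  mul_neg_geom_sum φ k

/-- The quotient whose maximum over `l` is `ratioBound`, in terms of geometric sums. -/
noncomputable def ratioTerm (n : ℕ) (φ : ℝ) (l : ℕ) : ℝ :=
  (φ + φ ^ (l + 2) * geomSum φ (n - l - 2)) / (1 + φ ^ (2 * l + 3) * geomSum φ (n - l - 2))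

theorem ratioTerm_denom_pos {φ : ℝ} (hφ : 0 < φ) (n l : ℕ) :
    0 < 1 + φ ^ (2 * l + 3) * geomSum φ (n - l - 2) := by
  have := mul_nonneg (pow_nonneg hφ.le (2 * l + 3)) (geomSum_nonneg hφ.le (n - l - 2))
  linarith

theorem ratioBound_eq (n a : ℕ) (φ : ℝ) :
    ratioBound n a φ = (Finset.Icc 0 (n - a)).sup' (nonempty_Icc.2 (Nat.zero_le _))
      (ratioTerm n φ) := by
  unfold ratioBound
  refine Finset.sup'_congr _ rfl fun l _ => ?_
  unfold ratioTerm
  rw [powSum_eq, powSum_eq, ← mul_assoc, ← mul_assoc, ← pow_add, ← pow_add,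
    show n - l - 1 + 1 - 2 = n - l - 2 by omega, show n - l + 1 - 3 = n - l - 2 by omega]

theorem ratioTerm_le_ratioBound {n a l : ℕ} (φ : ℝ) (hl : l ≤ n - a) :
    ratioTerm n φ l ≤ ratioBound n a φ := by
  rw [ratioBound_eq]
  exact Finset.le_sup' (ratioTerm n φ) (mem_Icc.2 ⟨Nat.zero_le _, hl⟩)

theorem le_ratioTerm_zero {n : ℕ} {φ : ℝ} (hφ0 : 0 < φ) (hφ1 : φ ≤ 1) :
    φ ≤ ratioTerm n φ 0 := by
  unfold ratioTerm
  rw [le_div_iff₀ (ratioTerm_denom_pos hφ0 n 0)]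
  have h1 : φ * φ ^ 3 ≤ φ ^ 2 := by
    rw [← pow_succ']
    exact pow_le_pow_of_le_one hφ0.le hφ1 (by norm_num)
  have h2 := mul_le_mul_of_nonneg_right h1 (geomSum_nonneg hφ0.le (n - 0 - 2))
  simp only [mul_zero, zero_add] at h2 ⊢
  linarith

theorem probRankEq_succ_div_le {n : ℕ} (σ₀ : Equiv.Perm (Fin n)) {φ : ℝ} (hφ0 : 0 < φ)
    (hφ1 : φ ≤ 1) {A : Finset (Fin n)} {u : Fin n} (hu : u ∈ A) {j : ℕ}
    (hr : projRank σ₀ A u ≤ j) (hj : j < A.card) :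
    probRankEq σ₀ φ A u (j + 1) / probRankEq σ₀ φ A u j ≤ ratioBound n A.card φ := by
  have hj1 : 1 ≤ j := ((Finset.mem_Icc.1 ((projRank_bijOn σ₀ A).mapsTo hu)).1).trans hr
  rw [div_le_iff₀ (probRankEq_pos σ₀ hφ0 hu hj1 hj.le), probRankEq_eq_weight_div,
    probRankEq_eq_weight_div, ← mul_div_assoc]
  refine div_le_div_of_nonneg_right ?_ (weight_nonneg hφ0.le _)
  have hcard : (A.map σ₀.toEmbedding).card = A.card := Finset.card_map _
  refine weight_rankSet_succ_le hφ0 hφ1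
    ((le_ratioTerm_zero hφ0 hφ1).trans (ratioTerm_le_ratioBound φ (Nat.zero_le _)))
    (by simpa using hu) (by rwa [hcard]) ?_ fun l hl => ?_
  · have := projRank_map σ₀ σ₀ A u
    rw [mul_inv_cancel] at this
    rwa [this]
  · rw [hcard] at hl
    rw [← div_le_iff₀ (ratioTerm_denom_pos hφ0 n l)]
    exact ratioTerm_le_ratioBound φ hl

/-! ### The equality case -/

theorem classSet_univ_last_iff {n : ℕ} {u y : Fin n} {j : ℕ} (hj : j + 1 = n) (hy : y ≠ u)
    {σ : Equiv.Perm (Fin n)} :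
    (σ ∈ classSet univ u j ∅ (univ.erase u) ∧ ∀ z ∈ univ.erase u, σ z ≤ σ y)
      ↔ σ ∈ pairSet univ u y j ∅ := by
  rw [mem_class_last_iff (by rw [Finset.card_univ, Fintype.card_fin]; omega) (by simpa using hy)]
  refine and_iff_left ?_
  ext z
  rw [mem_prefixSet, mem_erase]
  refine and_iff_left ?_
  have := Finset.card_le_univ (univ.filter fun y => σ y ≤ σ z)
  rw [Fintype.card_fin] at this
  unfold projRank
  omega

theorem lastSum_classSet_univ {n : ℕ} (φ : ℝ) {u : Fin n} {j : ℕ} (hj : j + 1 = n) {a b : Fin n}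
    (ha : a ∈ univ.erase u) (hb : b ∈ univ.erase u) (hab : a < b) :
    lastSum φ (classSet univ u j ∅ (univ.erase u)) (univ.erase u) a
      = φ ^ ((openPart (univ.erase u) a b).card + 1 + 2 * (openPart {u} a b).card)
        * lastSum φ (classSet univ u j ∅ (univ.erase u)) (univ.erase u) b := by
  refine rel_of_rel_adjacent φ (· = ·) (fun x y z => Eq.trans) (fun k x y h => congrArg _ h)
    (by simp) (fun a => lastSum φ (classSet univ u j ∅ (univ.erase u)) (univ.erase u) a) ?_
    a ha b hb hab
  intro a ha b hb hab he
  refine lastSum_eq_of_card_eq φ ha hb hab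
    (fun σ hσ => mul_swap_mem_classSet subset_rfl ha hb hσ) _ fun σ hσ hlast => ?_
  -- As `a` and `b` are neighbours in `univ.erase u`, only `u` can lie between them in value, and
  -- its position is then automatically between theirs.
  congr 1
  ext z
  simp only [betweenSet, mem_filter, mem_univ, true_and, mem_openPart]
  constructor
  · rintro ⟨h1, -⟩
    refine ⟨?_, h1⟩
    by_contra hz
    have : z ∈ openPart (univ.erase u) a b :=
      mem_openPart.2 ⟨mem_erase.2 ⟨by simpa using hz, mem_univ _⟩, h1⟩
    simp [he] at this
  · rintro ⟨h1, h2⟩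
    exact ⟨h2, between_of_mem_classSet (mem_univ u)
      (by rw [Finset.card_univ, Fintype.card_fin]; omega) hσ ha hlast hb hab.ne (by simpa using h1)⟩

/-- For the second largest element of `Fin n` the weights of the ranks `n - 1` and `n` are
explicit multiples of a common number. -/
theorem weight_rankSet_univ {n : ℕ} {φ : ℝ} (hφ : 0 < φ) {u : Fin n} {j : ℕ}
    (hju : j = (u : ℕ) + 1) (hj : j + 1 = n) :
    ∃ t : ℝ, weight φ (rankSet univ u (j + 1)) = (φ + φ ^ 2 * geomSum φ (n - 2)) * t ∧
      weight φ (rankSet univ u j) = (1 + φ ^ 3 * geomSum φ (n - 2)) * t := by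
  have hcard : j < (univ : Finset (Fin n)).card := by
    rw [Finset.card_univ, Fintype.card_fin]; omega
  set T : Fin n → ℝ :=
    fun y => lastSum φ (classSet univ u j ∅ (univ.erase u)) (univ.erase u) y with hT
  have hD : ∀ y, y ≠ u → weight φ (pairSet univ u y j ∅) = T y := by
    intro y hy
    unfold weight
    rw [hT]
    unfold lastSum
    congr 1
    ext σ
    rw [mem_filter, classSet_univ_last_iff hj hy]
  set x : Fin n := ⟨n - 1, by omega⟩ with hx
  have hux : u < x := by
    rw [Fin.lt_def]
    simp only [hx]
    omega
  set L : Finset (Fin n) := univ.filter fun y => y < u with hL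
  have hxL : x ∉ L := fun h => absurd (mem_filter.1 h).2 hux.not_gt
  have hsplit : univ.erase u = insert x L := by
    ext y
    simp only [mem_erase, mem_univ, and_true, mem_insert, hL, mem_filter, true_and, hx,
      Fin.ext_iff, Fin.lt_def, ne_eq]
    omega
  have hLcard : L.card = n - 2 := by
    have h1 : L = Iio u := by ext; simp [hL]
    rw [h1, Fin.card_Iio]
    omega
  have hlow : ∀ y ∈ L, T y = φ ^ (L.filter fun z => y < z).card * (φ ^ 3 * T x) := by
    intro y hy
    have hyu : y < u := (mem_filter.1 hy).2
    have h1 : openPart (univ.erase u) y x = L.filter fun z => y < z := by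
      ext z
      simp only [mem_openPart, mem_erase, mem_univ, and_true, mem_filter, hL, true_and, hx,
        Fin.ext_iff, Fin.lt_def, ne_eq]
      omega
    have h2 : openPart {u} y x = {u} :=
      Finset.filter_true_of_mem fun z hz => by
        rw [mem_singleton] at hz
        subst hz
        exact ⟨hyu, hux⟩
    have h3 := lastSum_classSet_univ φ hj (a := y) (b := x) (u := u) (by simp [hyu.ne])
      (by simp [hux.ne']) (hyu.trans hux)
    rw [h1, h2, Finset.card_singleton] at h3
    rw [hT]
    simp only
    rw [h3, ← mul_assoc, ← pow_add]
  -- All `n - 2` elements below `u` occur, so the geometric sum has full length.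
  have hsum : ∑ y ∈ L, T y = geomSum φ (n - 2) * (φ ^ 3 * T x) := by
    rw [Finset.sum_congr rfl hlow, ← Finset.sum_mul, sum_pow_card_gt, hLcard]
  obtain ⟨m, rfl⟩ : ∃ m, j = m + 1 := ⟨u, hju⟩
  have hNx : weight φ (pairSet univ x u (m + 1) ∅) = φ * T x := by
    rw [weight_pairSet_swap φ (mem_univ u) (mem_univ x) hux (disjoint_empty_left _),
      hD x hux.ne']
    simp [openPart]
  have hNlow : ∀ y ∈ L, weight φ (pairSet univ y u (m + 1) ∅) = φ⁻¹ * T y := by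
    intro y hy
    have hyu : y < u := (mem_filter.1 hy).2
    rw [← hD y hyu.ne, weight_pairSet_swap φ (mem_univ y) (mem_univ u) hyu
      (disjoint_empty_left _)]
    simp [openPart, hφ.ne']
  refine ⟨T x, ?_, ?_⟩
  · rw [weight_rankSet_succ φ u (by omega) hcard, Finset.compl_univ, Finset.powerset_empty,
      Finset.sum_singleton, hsplit, Finset.sum_insert hxL, hNx, Finset.sum_congr rfl hNlow,
      ← Finset.mul_sum, hsum]
    field_simp
  · rw [weight_rankSet φ u hcard, Finset.compl_univ, Finset.powerset_empty,
      Finset.sum_singleton,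
      Finset.sum_congr rfl fun y hy => hD y (mem_erase.1 hy).1, hsplit, Finset.sum_insert hxL,
      hsum]
    ring

theorem probRankEq_succ_div_eq {n : ℕ} (σ₀ : Equiv.Perm (Fin n)) {φ : ℝ} (hφ0 : 0 < φ)
    {u : Fin n} {j : ℕ} (hju : j = projRank σ₀ univ u) (hj : j + 1 = n) :
    probRankEq σ₀ φ univ u (j + 1) / probRankEq σ₀ φ univ u j
      = ratioBound n (univ : Finset (Fin n)).card φ := by
  have hr : projRank 1 univ (σ₀ u) = (σ₀ u : ℕ) + 1 := by
    unfold projRank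
    rw [← Fin.card_Iic]
    congr 1
    ext y
    rw [mem_filter, mem_Iic]
    exact and_iff_right (mem_univ y)
  have hmap : (univ : Finset (Fin n)).map σ₀.toEmbedding = univ := Finset.map_univ_equiv σ₀
  have hj' : j = (σ₀ u : ℕ) + 1 := by
    have h1 := projRank_map σ₀ σ₀ univ u
    rw [mul_inv_cancel, hmap] at h1
    omega
  have hpos := probRankEq_pos σ₀ hφ0 (mem_univ u) (j := j) (by omega)
    (by rw [Finset.card_univ, Fintype.card_fin]; omega)
  rw [probRankEq_eq_weight_div, hmap] at hpos
  rw [probRankEq_eq_weight_div, probRankEq_eq_weight_div, hmap]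
  obtain ⟨t, hN, hD⟩ := weight_rankSet_univ hφ0 hj' hj
  have hb : ratioBound n (univ : Finset (Fin n)).card φ = ratioTerm n φ 0 := by
    rw [ratioBound_eq]
    simp
  rw [hD] at hpos
  have hZ : weight φ (univ : Finset (Equiv.Perm (Fin n))) ≠ 0 := fun h => by
    rw [h, div_zero] at hpos
    exact lt_irrefl _ hpos
  have ht : t ≠ 0 := by
    rintro rfl
    simp at hpos
  rw [hb, hN, hD, div_div_div_cancel_right₀ hZ, mul_div_mul_right _ _ ht]
  simp [ratioTerm]

/-! ### The closed form of the bound -/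

/-- The left side is nonincreasing in `l` and equals the right side at `l = 0`. Multiplied by `1 -
φ`, a successive difference has the sign of `1 - φ^l (φ + φ^2) + φ^(n-1)`, positive by `h`. -/
theorem geomSum_mul_one_sub_pow_le {n : ℕ} {φ : ℝ} (hφ0 : 0 < φ) (hφ1 : φ < 1)
    (h : φ + φ ^ 2 < 1 + φ ^ n) (l : ℕ) :
    φ ^ (l + 2) * geomSum φ (n - l - 2) * (1 - φ ^ (l + 1))
      ≤ φ ^ 2 * geomSum φ (n - 2) * (1 - φ) := by
  induction l with
  | zero => simp
  | succ l ih =>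
    refine le_trans ?_ ih
    by_cases hl : n ≤ l + 3
    · have h0 : n - (l + 1) - 2 = 0 := by omega
      have h1 : φ ^ (l + 1) ≤ 1 := pow_le_one₀ hφ0.le hφ1.le
      rw [h0, geomSum, Finset.range_zero, Finset.sum_empty, mul_zero, zero_mul]
      exact mul_nonneg (mul_nonneg (pow_nonneg hφ0.le _) (geomSum_nonneg hφ0.le _))
        (sub_nonneg.2 h1)
    · obtain ⟨k, rfl⟩ : ∃ k, n = k + 1 + l + 2 := ⟨n - l - 3, by omega⟩
      rw [show k + 1 + l + 2 - (l + 1) - 2 = k by omega,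
        show k + 1 + l + 2 - l - 2 = k + 1 by omega]
      have hk := one_sub_mul_geomSum φ k
      have hk' := one_sub_mul_geomSum φ (k + 1)
      have hpos : 0 < 1 - φ := sub_pos.2 hφ1
      refine le_of_mul_le_mul_left ?_ hpos
      have e1 : (1 - φ) * (φ ^ (l + 1 + 2) * geomSum φ k * (1 - φ ^ (l + 1 + 1)))
          = φ ^ (l + 3) * (1 - φ ^ k) * (1 - φ ^ (l + 2)) := by
        rw [← hk]; ring
      have e2 : (1 - φ) * (φ ^ (l + 2) * geomSum φ (k + 1) * (1 - φ ^ (l + 1)))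
          = φ ^ (l + 2) * (1 - φ ^ (k + 1)) * (1 - φ ^ (l + 1)) := by
        rw [← hk']; ring
      rw [e1, e2, ← sub_nonneg]
      have e3 : φ ^ (l + 2) * (1 - φ ^ (k + 1)) * (1 - φ ^ (l + 1))
          - φ ^ (l + 3) * (1 - φ ^ k) * (1 - φ ^ (l + 2))
          = φ ^ (l + 2) * ((1 - φ) * (1 - φ ^ l * (φ + φ ^ 2) + φ ^ (k + 1 + l + 1))) := by
        ring
      rw [e3]
      refine mul_nonneg (pow_nonneg hφ0.le _) (mul_nonneg hpos.le ?_)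
      have h1 : φ ^ l * (φ + φ ^ 2) ≤ φ + φ ^ 2 :=
        mul_le_of_le_one_left (by positivity) (pow_le_one₀ hφ0.le hφ1.le)
      have h2 : φ ^ (k + 1 + l + 2) ≤ φ ^ (k + 1 + l + 1) :=
        pow_le_pow_of_le_one hφ0.le hφ1.le (by omega)
      linarith

theorem ratioTerm_le_zero {n : ℕ} (hn : 2 ≤ n) {φ : ℝ} (hφ0 : 0 < φ) (hφ1 : φ ≤ 1)
    (h : φ + φ ^ 2 < 1 + φ ^ n) (l : ℕ) : ratioTerm n φ l ≤ ratioTerm n φ 0 := by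
  have hφ : φ < 1 := by
    refine lt_of_le_of_ne hφ1 ?_
    rintro rfl
    norm_num at h
  have key := geomSum_mul_one_sub_pow_le hφ0 hφ h l
  unfold ratioTerm
  rw [div_le_div_iff₀ (ratioTerm_denom_pos hφ0 n l) (ratioTerm_denom_pos hφ0 n 0)]
  simp only [mul_zero, zero_add, Nat.sub_zero]
  rw [show φ ^ (2 * l + 3) * geomSum φ (n - l - 2)
    = φ ^ (l + 1) * (φ ^ (l + 2) * geomSum φ (n - l - 2)) by ring,
    show φ ^ 3 * geomSum φ (n - 2) = φ * (φ ^ 2 * geomSum φ (n - 2)) by ring]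
  have hs : 0 ≤ φ ^ (l + 2) * geomSum φ (n - l - 2) :=
    mul_nonneg (pow_nonneg hφ0.le _) (geomSum_nonneg hφ0.le _)
  -- After multiplication by `1 - φ` this is the hypothesis `h`, up to strictness.
  have hs1 : φ ^ 2 * geomSum φ (n - 2) ≤ 1 := by
    refine le_of_mul_le_mul_left ?_ (sub_pos.2 hφ)
    have h1 := one_sub_mul_geomSum φ (n - 2)
    have h2 : φ ^ 2 * φ ^ (n - 2) = φ ^ n := by
      rw [← pow_add]
      congr 1
      omega
    have h3 : (1 - φ) * (φ ^ 2 * geomSum φ (n - 2)) = φ ^ 2 - φ ^ n := by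
      rw [← h2, mul_left_comm, h1]
      ring
    rw [h3]
    linarith
  have hq : φ ^ (l + 1) ≤ φ := by
    rw [pow_succ]
    exact mul_le_of_le_one_left hφ0.le (pow_le_one₀ hφ0.le hφ1)
  generalize φ ^ (l + 2) * geomSum φ (n - l - 2) = s at *
  generalize φ ^ 2 * geomSum φ (n - 2) = s₀ at *
  generalize φ ^ (l + 1) = q at *
  -- The quotients are `(φ + s) / (1 + q s)` and `(φ + s₀) / (1 + φ s₀)`; the cross-multiplied
  -- difference is exactly the sum of the two nonnegative quantities below.
  have h1 : 0 ≤ s * (1 - s₀) * (φ - q) :=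
    mul_nonneg (mul_nonneg hs (sub_nonneg.2 hs1)) (sub_nonneg.2 hq)
  have h2 : 0 ≤ (1 + φ) * (s₀ * (1 - φ) - s * (1 - q)) :=
    mul_nonneg (by linarith) (sub_nonneg.2 key)
  linarith

theorem ratioBound_le {n : ℕ} (hn : 2 ≤ n) (a : ℕ) {φ : ℝ} (hφ0 : 0 < φ) (hφ1 : φ ≤ 1)
    (h : φ + φ ^ 2 < 1 + φ ^ n) :
    ratioBound n a φ ≤ powSum φ 1 (n - 1) / (1 + powSum φ 3 n) := by
  have hz : powSum φ 1 (n - 1) / (1 + powSum φ 3 n) = ratioTerm n φ 0 := by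
    obtain ⟨m, rfl⟩ := Nat.exists_eq_add_of_le' hn
    rw [powSum_eq, powSum_eq, ratioTerm, show m + 2 - 1 + 1 - 1 = m + 1 by omega,
      show m + 2 + 1 - 3 = m by omega, show m + 2 - 0 - 2 = m by omega, geomSum_succ]
    congr 1
    ring
  rw [hz, ratioBound_eq]
  exact Finset.sup'_le _ _ fun l _ => ratioTerm_le_zero hn hφ0 hφ1 h l

end Mallows

theorem lemma4p3 (n : ℕ) (σ₀ : Equiv.Perm (Fin n)) (φ : ℝ) (hφ0 : 0 < φ) (hφ1 : φ ≤ 1)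
    (A : Finset (Fin n)) (u : Fin n) (hu : u ∈ A) :
    -- all probabilities occurring in the ratios are positive
    (∀ j : ℕ, 1 ≤ j → j ≤ A.card → 0 < Mallows.probRankEq σ₀ φ A u j) ∧
    -- 1)
    (∀ j : ℕ, Mallows.projRank σ₀ A u ≤ j → j < A.card →
      Mallows.probRankEq σ₀ φ A u (j + 1) / Mallows.probRankEq σ₀ φ A u j
        ≤ Mallows.ratioBound n A.card φ) ∧
    -- 2)
    (∀ j : ℕ, 1 < j → j ≤ Mallows.projRank σ₀ A u →
      Mallows.probRankEq σ₀ φ A u (j - 1) / Mallows.probRankEq σ₀ φ A u j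
        ≤ Mallows.ratioBound n A.card φ) ∧
    -- the bound in 1) is attained for `A = [n]`, `σ₀(u) = n - 1`, `j = σ₀(u)`
    (A = Finset.univ → ∀ j : ℕ, j = Mallows.projRank σ₀ A u → j + 1 = n →
      Mallows.probRankEq σ₀ φ A u (j + 1) / Mallows.probRankEq σ₀ φ A u j
        = Mallows.ratioBound n A.card φ) ∧
    -- the bound in 2) is attained for `A = [n]`, `σ₀(u) = 2`, `j = σ₀(u)`
    (A = Finset.univ → ∀ j : ℕ, j = Mallows.projRank σ₀ A u → j = 2 →
      Mallows.probRankEq σ₀ φ A u (j - 1) / Mallows.probRankEq σ₀ φ A u j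
        = Mallows.ratioBound n A.card φ) ∧
    (2 ≤ n → φ + φ ^ 2 < 1 + φ ^ n →
      Mallows.ratioBound n A.card φ
        ≤ Mallows.powSum φ 1 (n - 1) / (1 + Mallows.powSum φ 3 n)) := by
  have hrev := Mallows.projRank_rev_add σ₀ hu
  have hrank : 1 ≤ Mallows.projRank σ₀ A u ∧ Mallows.projRank σ₀ A u ≤ A.card :=
    Finset.mem_Icc.1 ((Mallows.projRank_bijOn σ₀ A).mapsTo hu)
  refine ⟨fun j h1 h2 => Mallows.probRankEq_pos σ₀ hφ0 hu h1 h2,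
    fun j h1 h2 => Mallows.probRankEq_succ_div_le σ₀ hφ0 hφ1 hu h1 h2,
    fun j h1 h2 => ?_, ?_, ?_,
    fun hn h => Mallows.ratioBound_le hn A.card hφ0 hφ1 h⟩
  · have h3 := Mallows.probRankEq_succ_div_le (Fin.revPerm * σ₀) hφ0 hφ1 hu
      (j := A.card + 1 - j) (by omega) (by omega)
    rwa [Mallows.probRankEq_rev σ₀ φ hu (j := j - 1) (by omega),
      Mallows.probRankEq_rev σ₀ φ hu (j := j) (by omega)] at h3
  · rintro rfl j h1 h2
    exact Mallows.probRankEq_succ_div_eq σ₀ hφ0 h1 h2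
  · rintro rfl j h1 rfl
    have hcard : (Finset.univ : Finset (Fin n)).card = n := Finset.card_fin n
    -- Reversal sends ranks `2` and `1` to `n - 1` and `n`; here `n ≥ 2` because `u` has rank `2`.
    have h3 := Mallows.probRankEq_succ_div_eq (Fin.revPerm * σ₀) hφ0 (u := u)
      (j := n - 1) (by omega) (by omega)
    rwa [Mallows.probRankEq_rev σ₀ φ hu (j := 1) (by omega),
      Mallows.probRankEq_rev σ₀ φ hu (j := 2) (by omega)] at h3
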